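/- A Gauss word is a finite sequence of letters in which every letter that appears, appears exactly twice; $\emptyset$ is the empty Gauss word. An isomorphism of Gauss words is a bijection between their alphabets (sets of appearing letters) which, applied letterwise, takes one word to the other. Consider the following moves between Gauss words, where $A,B,C$ are letters and $x,y,z,t$ are possibly empty sequences of letters: $$\text{Shift: } AxAy\leftrightarrow xAyA,\quad \text{H1: } xAAy\leftrightarrow xy,\quad \text{H2: } xAByBAz\leftrightarrow xyz,\quad \text{H3: } xAByACzBCt\leftrightarrow xBAyCAzCBt.$$ Two Gauss words are homotopic if a finite sequence of isomorphisms and of these moves transforms one into the other; they are open homotopic if this can be done without the shift move. A Gauss word is (open) homotopically trivial if it is (open) homotopic to $\emptyset$. A two-component Gauss phrase $u|v$ is a pair of words $u,v$ whose concatenation $uv$ is a Gauss word. Isomorphisms are bijections of alphabets applied letterwise to both components, and H1, H2, H3 apply to phrases, with $x,y,z,t$ allowed to contain the separator $|$. Mixed homotopy of two-component Gauss phrases is the equivalence relation generated by isomorphisms, H1, H2, H3, and the shift $Ax|v\leftrightarrow xA|v$ of the first component only; $\langle p\rangle$ denotes the mixed homotopy class of $p$. Let $H$ be the free abelian group on the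 set of mixed homotopy classes, and $\phi\colon H\to H/2H$ the natural homomorphism. For a letter $A$ of a Gauss word $w=xAyAz$ let $p(w,A)=y|xz$, and put $$z_o(w)=\phi\Bigl(\sum_{A\in w}\bigl(\langle p(w,A)\rangle-\langle\emptyset|w\rangle\bigr)\Bigr)\in H/2H,$$ the sum being over the letters of $w$, each taken once. Let $w=ABACDCBD$ with $A,B,C,D$ distinct letters. Then: 1. $w$ is homotopically trivial. 2. The mixed homotopy classes $\langle B|CDCBD\rangle$, $\langle ACDC|AD\rangle$, $\langle D|D\rangle$, $\langle CB|ABAC\rangle$ are pairwise distinct, and $$z_o(w)=\phi(\langle B|CDCBD\rangle)+\phi(\langle ACDC|AD\rangle)+\phi(\langle D|D\rangle)+\phi(\langle CB|ABAC\rangle)\neq 0.$$ 3. $w$ is not open homotopically trivial. Hence open homotopy of Gauss words is strictly finer than homotopy: open homotopic Gauss words are homotopic, and there are Gauss words that are homotopic but not open homotopic. -/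

import Mathlib

/-! Letters are natural numbers, an inexhaustible supply of names; words are finite sequences of
letters. The alphabet of a Gauss word is the set of letters that appear in it. -/

namespace GaussHomotopy

/-- Every letter that appears in `w` appears exactly twice. -/
abbrev IsGauss (w : List ℕ) : Prop := ∀ a ∈ w, w.count a = 2

/-- Gauss words. -/
abbrev GaussWord : Type := {w : List ℕ // IsGauss w}

/-- The trivial Gauss word. -/
def emptyWord : GaussWord := ⟨[], by decide⟩

/-- The moves H1, H2, H3 (from left to right) on sequences of symbols. The map `ι` turns letters
into symbols: it is the identity for words, and `some` for phrases, whose symbols are the letters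
and the component separator `none`. So `t`, `x`, `y`, `z` may contain separators, whereas
`A`, `B`, `C` are letters. -/
inductive HMove {S : Type} (ι : ℕ → S) : List S → List S → Prop
  | h1 (A : ℕ) (x y : List S) :
      HMove ι (x ++ [ι A, ι A] ++ y) (x ++ y)
  | h2 (A B : ℕ) (x y z : List S) :
      HMove ι (x ++ [ι A, ι B] ++ y ++ [ι B, ι A] ++ z) (x ++ y ++ z)
  | h3 (A B C : ℕ) (x y z t : List S) :
      HMove ι (x ++ [ι A, ι B] ++ y ++ [ι A, ι C] ++ z ++ [ι B, ι C] ++ t)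
        (x ++ [ι B, ι A] ++ y ++ [ι C, ι A] ++ z ++ [ι C, ι B] ++ t)

/-- The shift move `AxAy → xAyA` on words. -/
inductive ShiftMove : List ℕ → List ℕ → Prop
  | shift (A : ℕ) (x y : List ℕ) :
      ShiftMove ([A] ++ x ++ [A] ++ y) (x ++ [A] ++ y ++ [A])

/-- Isomorphism of Gauss words: a bijection between the alphabets that takes `u` to `v`
letterwise. -/
def WordIso (u v : List ℕ) : Prop :=
  ∃ f : ℕ → ℕ, Set.BijOn f {a | a ∈ u} {a | a ∈ v} ∧ u.map f = v

/-- One step of open homotopy of Gauss words. -/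
def OpenStep (u v : GaussWord) : Prop := WordIso u.1 v.1 ∨ HMove id u.1 v.1

/-- One step of homotopy of Gauss words. -/
def HomotopyStep (u v : GaussWord) : Prop :=
  WordIso u.1 v.1 ∨ HMove id u.1 v.1 ∨ ShiftMove u.1 v.1

/-- Open homotopy: finite sequences of isomorphisms and moves H1, H2, H3, in both directions. -/
def OpenHomotopic : GaussWord → GaussWord → Prop := Relation.EqvGen OpenStep

/-- Homotopy: finite sequences of isomorphisms, shift moves and moves H1, H2, H3, in both
directions. -/
def Homotopic : GaussWord → GaussWord → Prop := Relation.EqvGen HomotopyStep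

/-- Gauss phrases with two components, `u|v` being the pair `(u, v)`. -/
abbrev GaussPhrase : Type := {p : List ℕ × List ℕ // IsGauss (p.1 ++ p.2)}

/-- The phrase `u|v` written out as a sequence of letters and one separator. -/
def symbols (p : List ℕ × List ℕ) : List (Option ℕ) :=
  p.1.map some ++ [none] ++ p.2.map some

/-- Isomorphism of two-component Gauss phrases. -/
def PhraseIso (p q : List ℕ × List ℕ) : Prop :=
  ∃ f : ℕ → ℕ, Set.BijOn f {a | a ∈ p.1 ++ p.2} {a | a ∈ q.1 ++ q.2} ∧
    p.1.map f = q.1 ∧ p.2.map f = q.2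

/-- The shift move `Ax|v → xA|v` on the first component. -/
inductive ShiftFirst : List ℕ × List ℕ → List ℕ × List ℕ → Prop
  | shift (A : ℕ) (x v : List ℕ) : ShiftFirst ([A] ++ x, v) (x ++ [A], v)

/-- One step of mixed homotopy: the first component is closed, the second one is open. -/
def MixedStep (p q : GaussPhrase) : Prop :=
  PhraseIso p.1 q.1 ∨ HMove some (symbols p.1) (symbols q.1) ∨ ShiftFirst p.1 q.1

/-- Mixed homotopy of two-component Gauss phrases. -/
def mixedSetoid : Setoid GaussPhrase := Relation.EqvGen.setoid MixedStep

/-- The set of mixed homotopy classes of two-component Gauss phrases. -/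
def MixedClass : Type := Quotient mixedSetoid

/-- The mixed homotopy class of a phrase. -/
def mixedClass (p : GaussPhrase) : MixedClass := Quotient.mk mixedSetoid p

/-- For `w = xAyAz` with exactly two occurrences of `A`, this is the phrase `y|xz`. -/
def split (w : List ℕ) (A : ℕ) : List ℕ × List ℕ :=
  let x := w.takeWhile (· ≠ A)
  let r := (w.dropWhile (· ≠ A)).tail
  (r.takeWhile (· ≠ A), x ++ (r.dropWhile (· ≠ A)).tail)

theorem split_eq (A : ℕ) (x y z : List ℕ) (hx : A ∉ x) (hy : A ∉ y) :
    split (x ++ [A] ++ y ++ [A] ++ z) A = (y, x ++ z) := by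
  have key : ∀ l m : List ℕ, A ∉ l →
      (l ++ A :: m).takeWhile (· ≠ A) = l ∧ (l ++ A :: m).dropWhile (· ≠ A) = A :: m := by
    intro l m hl
    induction l with
    | nil => simp
    | cons b l ih =>
      have hb : b ≠ A := fun h => hl (by simp [h])
      have := ih (fun h => hl (by simp [h]))
      simp_all
  have e : x ++ [A] ++ y ++ [A] ++ z = x ++ A :: (y ++ A :: z) := by simp
  rw [e]
  simp only [split]
  rw [(key x _ hx).1, (key x _ hx).2, List.tail_cons, (key y _ hy).1, (key y _ hy).2,
    List.tail_cons]

theorem exists_split (w : List ℕ) (A : ℕ) (h : w.count A = 2) :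
    ∃ x y z, A ∉ x ∧ A ∉ y ∧ A ∉ z ∧ w = x ++ [A] ++ y ++ [A] ++ z := by
  obtain ⟨x, r, rfl, hx⟩ := List.eq_append_cons_of_mem
    (List.count_pos_iff.1 (by omega : 0 < w.count A))
  have hr : r.count A = 1 := by
    simpa [List.count_append, List.count_eq_zero_of_not_mem hx] using h
  obtain ⟨y, z, rfl, hy⟩ := List.eq_append_cons_of_mem
    (List.count_pos_iff.1 (by omega : 0 < r.count A))
  have hz : z.count A = 0 := by
    simpa [List.count_append, List.count_eq_zero_of_not_mem hy] using hr
  exact ⟨x, y, z, hx, hy, List.count_eq_zero.1 hz, by simp⟩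

theorem split_isGauss (w : GaussWord) (A : ℕ) (hA : A ∈ w.1) :
    IsGauss ((split w.1 A).1 ++ (split w.1 A).2) := by
  obtain ⟨w, hw⟩ := w
  obtain ⟨x, y, z, hx, hy, hz, rfl⟩ := exists_split w A (hw A hA)
  rw [split_eq A x y z hx hy]
  intro a ha
  have hne : A ≠ a := by
    rintro rfl
    simp_all
  have hm : a ∈ x ++ [A] ++ y ++ [A] ++ z := by
    simp only [List.mem_append] at ha ⊢
    tauto
  have := hw a hm
  simp only [List.count_append, List.count_singleton, beq_iff_eq, hne, if_false] at this ⊢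
  omega

/-- The Gauss phrase `p(w, A)`, for a letter `A` of the Gauss word `w`. -/
def phraseAt (w : GaussWord) (A : ℕ) (hA : A ∈ w.1) : GaussPhrase :=
  ⟨split w.1 A, split_isGauss w A hA⟩

/-- The Gauss phrase `∅|w`. -/
def emptyBar (w : GaussWord) : GaussPhrase := ⟨([], w.1), w.2⟩

/-- The free abelian group on the set of mixed homotopy classes. -/
abbrev H : Type := FreeAbelianGroup MixedClass

/-- The subgroup `2H` of `H`. -/
def twoH : AddSubgroup H := (nsmulAddMonoidHom (α := H) 2).range

/-- `H / 2H`. -/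
abbrev Zo : Type := H ⧸ twoH

/-- The natural homomorphism `H → H / 2H`. -/
def phi : H →+ Zo := QuotientAddGroup.mk' twoH

/-- `h(w) = ∑_{A ∈ w} (u_m(w, A) - t_m(w))`, with each letter of `w` counted once. -/
noncomputable def h (w : GaussWord) : H :=
  ∑ A ∈ w.1.toFinset.attach,
    (FreeAbelianGroup.of (mixedClass (phraseAt w A.1 (List.mem_toFinset.1 A.2))) -
      FreeAbelianGroup.of (mixedClass (emptyBar w)))

/-- The invariant `z_o`. -/
noncomputable def zo (w : GaussWord) : Zo := phi (h w)

/-- The Gauss word `ABACDCBD`, with `A, B, C, D = 0, 1, 2, 3`. -/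
def wordABACDCBD : GaussWord := ⟨[0, 1, 0, 2, 3, 2, 1, 3], by decide⟩

/-- The Gauss phrase `B|CDCBD`. -/
def phraseA : GaussPhrase := ⟨([1], [2, 3, 2, 1, 3]), by decide⟩

/-- The Gauss phrase `ACDC|AD`. -/
def phraseB : GaussPhrase := ⟨([0, 2, 3, 2], [0, 3]), by decide⟩

/-- The Gauss phrase `D|D`. -/
def phraseC : GaussPhrase := ⟨([3], [3]), by decide⟩

/-- The Gauss phrase `CB|ABAC`. -/
def phraseD : GaussPhrase := ⟨([2, 1], [0, 1, 0, 2]), by decide⟩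

end GaussHomotopy

/-!
The word `w = ABACDCBD` becomes trivial once shifts are allowed, by an explicit sequence of moves
(`homotopic_wordABACDCBD`). That it is not trivial without shifts is detected by `zo`.

*Derived moves.* H1, H2 and H3 imply the parallel form `xAByABz ↔ xyz` of H2
(`seqHomotopic_h2_parallel`), the renaming of letters, and two further forms of H3, in which the
letters of some of the pairs are exchanged (`seqHomotopic_h3_second`, `seqHomotopic_h3_third`).
They are proved for sequences of symbols, so that they hold for words and for phrases alike; every
intermediate sequence is kept a Gauss sequence by inserting fresh letters only.

*Invariance of `zo`* (`zo_eq_of_openHomotopic`). Let a move take `u` to `v`. At a letter `D` not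
involved in the move, the split phrases `p(u, D)` and `p(v, D)` are related by the same move, except
that the three pairs of H3 may come in a different order; this is where the derived forms are
needed (`seqHomotopic_split_h3`). The letter removed by H1 contributes `⟨∅|u⟩ - ⟨∅|u⟩ = 0`. The two
letters removed by H2 contribute equal terms, which cancel modulo two. For each letter of H3 the
two split phrases are mixed homotopic. Since `zo` vanishes on the empty word, it remains to see
`zo w ≠ 0`.

*Distinct mixed homotopy classes* (`mixedClass_nodup`). For a phrase `u|v`, attach to a letter of
`v` the reflection `m` of the dihedral group of order 8 if the letter also appears in `u`, and the
reflection `n` otherwise, where `mn` has order 4. The product over `v` is invariant under mixed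
homotopy: H1 and H2 delete factors `mm` or `nn`, and H3 changes the product only if exactly two of
its pairs lie in `v`, in which case it exchanges `mn` and `nm` at two places; this has no effect,
as the commutator of `m` and `n` is central of order two (`sr_exchange_twice`). The values on the
four phrases are `nnnmn = m·(mn)²`, `mm = 1`, `m` and `nmnm = (mn)²`. Being distinct elements of a
basis of `H`, the four classes have a nonzero sum modulo two.
-/

namespace GaussHomotopy

/-! ### Moves on sequences of symbols -/

section Sequences

variable {S : Type} [DecidableEq S] {ι : ℕ → S}

/-- A sequence of symbols in which every letter appears either twice or not at all. Symbols
outside the range of `ι`, such as separators, are unrestricted. -/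
def GaussSeq (ι : ℕ → S) (s : List S) : Prop :=
  ∀ a, s.count (ι a) = 0 ∨ s.count (ι a) = 2

/-- The equivalence relation on sequences of symbols generated by the moves H1, H2, H3 between
Gauss sequences. Neither isomorphisms nor shifts are included. -/
def SeqHomotopic (ι : ℕ → S) : List S → List S → Prop :=
  Relation.EqvGen fun s t => GaussSeq ι s ∧ GaussSeq ι t ∧ HMove ι s t

theorem SeqHomotopic.symm {s t : List S} (h : SeqHomotopic ι s t) : SeqHomotopic ι t s :=
  Relation.EqvGen.symm _ _ h

theorem SeqHomotopic.trans {s t r : List S} (h : SeqHomotopic ι s t) (h' : SeqHomotopic ι t r) :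
    SeqHomotopic ι s r :=
  Relation.EqvGen.trans _ _ _ h h'

/-- Let objects `p : X` be spelled by sequences `F p`. If single moves relate spellings only to
spellings, and objects whose spellings differ by a single move are equivalent under `R`, then so
are objects with homotopic spellings. -/
theorem SeqHomotopic.of_spelling {X : Type} {F : X → List S} {R : X → X → Prop}
    (hF : F.Injective) (hR : Equivalence R)
    (hmove : ∀ p q, HMove ι (F p) (F q) → R p q)
    (hlift : ∀ s t, GaussSeq ι s → GaussSeq ι t → HMove ι s t →
      ((∃ p, F p = s) ↔ ∃ q, F q = t))
    {p q : X} (h : SeqHomotopic ι (F p) (F q)) : R p q := by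
  have key : ∀ s t, SeqHomotopic ι s t →
      (∀ p, F p = s → ∃ q, F q = t ∧ R p q) ∧ (∀ q, F q = t → ∃ p, F p = s ∧ R p q) := by
    intro s t h
    induction h with
    | rel s t h =>
      obtain ⟨hs, ht, hm⟩ := h
      constructor
      · rintro p rfl
        obtain ⟨q, rfl⟩ := (hlift _ _ hs ht hm).1 ⟨p, rfl⟩
        exact ⟨q, rfl, hmove _ _ hm⟩
      · rintro q rfl
        obtain ⟨p, rfl⟩ := (hlift _ _ hs ht hm).2 ⟨q, rfl⟩
        exact ⟨p, rfl, hmove _ _ hm⟩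
    | refl s => exact ⟨fun p hp => ⟨p, hp, hR.refl p⟩, fun p hp => ⟨p, hp, hR.refl p⟩⟩
    | symm s t _ ih =>
      refine ⟨fun p hp => ?_, fun p hp => ?_⟩
      · obtain ⟨q, hq, e⟩ := ih.2 p hp
        exact ⟨q, hq, hR.symm e⟩
      · obtain ⟨q, hq, e⟩ := ih.1 p hp
        exact ⟨q, hq, hR.symm e⟩
    | trans s t r _ _ ih₁ ih₂ =>
      refine ⟨fun p hp => ?_, fun p hp => ?_⟩
      · obtain ⟨q, hq, e⟩ := ih₁.1 p hp
        obtain ⟨q', hq', e'⟩ := ih₂.1 q hq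
        exact ⟨q', hq', hR.trans e e'⟩
      · obtain ⟨q, hq, e⟩ := ih₂.2 p hp
        obtain ⟨q', hq', e'⟩ := ih₁.2 q hq
        exact ⟨q', hq', hR.trans e' e⟩
  obtain ⟨q', hq', e⟩ := (key _ _ h).1 p rfl
  rwa [hF hq'] at e

theorem exists_fresh (hι : ι.Injective) (s : List S) : ∃ a, ι a ∉ s := by
  obtain ⟨a, ha⟩ := Infinite.exists_notMem_finset (s.toFinset.preimage ι hι.injOn)
  exact ⟨a, by simpa using ha⟩

theorem GaussSeq.perm {s t : List S} (h : GaussSeq ι s) (p : s.Perm t) : GaussSeq ι t := by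
  intro a
  rw [← p.count_eq]
  exact h a

theorem GaussSeq.remove {s t : List S} {a : ℕ} (h : GaussSeq ι s)
    (p : s.Perm (ι a :: ι a :: t)) : GaussSeq ι t := by
  intro c
  have := h.perm p c
  by_cases hc : ι a = ι c
  · simp only [List.count_cons, hc, beq_self_eq_true, if_true] at this
    omega
  · simpa [List.count_cons, hc] using this

theorem GaussSeq.insert {s t : List S} {a : ℕ} (h : GaussSeq ι s) (ha : ι a ∉ s)
    (p : t.Perm (ι a :: ι a :: s)) : GaussSeq ι t := by
  refine GaussSeq.perm (fun c => ?_) p.symm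
  by_cases hc : ι a = ι c
  · rw [hc] at ha
    simp [hc, List.count_eq_zero_of_not_mem ha]
  · simpa [List.count_cons, hc] using h c

theorem GaussSeq.remove₂ {s t : List S} {a b : ℕ} (h : GaussSeq ι s)
    (p : s.Perm (ι a :: ι a :: ι b :: ι b :: t)) : GaussSeq ι t :=
  (h.remove p).remove (List.Perm.refl _)

theorem GaussSeq.insert₂ {s t : List S} {a b : ℕ} (h : GaussSeq ι s) (ha : ι a ∉ s)
    (hb : ι b ∉ ι a :: s) (p : t.Perm (ι b :: ι b :: ι a :: ι a :: s)) : GaussSeq ι t :=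
  (h.insert ha (List.Perm.refl _)).insert (by simpa using hb) p

theorem seqHomotopic_h1 {a : ℕ} {x y : List S} (h : GaussSeq ι (x ++ ι a :: ι a :: y)) :
    SeqHomotopic ι (x ++ ι a :: ι a :: y) (x ++ y) := by
  refine Relation.EqvGen.rel _ _ ⟨h, h.remove (a := a) ?_, by simpa using HMove.h1 (ι := ι) a x y⟩
  refine List.perm_iff_count.2 fun c => ?_
  simp only [List.count_append, List.count_cons]
  ring

theorem seqHomotopic_h2 {a b : ℕ} {x y z : List S}
    (h : GaussSeq ι (x ++ ι a :: ι b :: (y ++ ι b :: ι a :: z))) :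
    SeqHomotopic ι (x ++ ι a :: ι b :: (y ++ ι b :: ι a :: z)) (x ++ (y ++ z)) := by
  refine Relation.EqvGen.rel _ _
    ⟨h, h.remove₂ (a := a) (b := b) ?_, by simpa using HMove.h2 (ι := ι) a b x y z⟩
  refine List.perm_iff_count.2 fun c => ?_
  simp only [List.count_append, List.count_cons]
  ring

theorem seqHomotopic_h3 {a b c : ℕ} {x y z t : List S}
    (h : GaussSeq ι (x ++ ι a :: ι b :: (y ++ ι a :: ι c :: (z ++ ι b :: ι c :: t)))) :
    SeqHomotopic ι (x ++ ι a :: ι b :: (y ++ ι a :: ι c :: (z ++ ι b :: ι c :: t)))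
      (x ++ ι b :: ι a :: (y ++ ι c :: ι a :: (z ++ ι c :: ι b :: t))) := by
  refine Relation.EqvGen.rel _ _ ⟨h, h.perm ?_, by simpa using HMove.h3 (ι := ι) a b c x y z t⟩
  refine List.perm_iff_count.2 fun c => ?_
  simp only [List.count_append, List.count_cons]
  ring

theorem seqHomotopic_h3_symm {a b c : ℕ} {x y z t : List S}
    (h : GaussSeq ι (x ++ ι b :: ι a :: (y ++ ι c :: ι a :: (z ++ ι c :: ι b :: t)))) :
    SeqHomotopic ι (x ++ ι b :: ι a :: (y ++ ι c :: ι a :: (z ++ ι c :: ι b :: t)))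
      (x ++ ι a :: ι b :: (y ++ ι a :: ι c :: (z ++ ι b :: ι c :: t))) := by
  refine (seqHomotopic_h3 (h.perm ?_)).symm
  refine List.perm_iff_count.2 fun c => ?_
  simp only [List.count_append, List.count_cons]
  ring

/-- The parallel form `xAByABz ↔ xyz` of H2. Two H2 moves insert letters `P`, `Q`, then `R`, `T`,
and give `xPRTQABQPyABTRz`. There H3 applies to the pairs `TQ`, `BQ`, `BT`, and the result
`xPRQTAQBPyATBRz` is reduced by H2 (removing `T`, `A`), H1 (`Q`), H2 (`R`, `B`) and H1 (`P`). -/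
theorem seqHomotopic_h2_parallel (hι : ι.Injective) {a b : ℕ} {x y z : List S}
    (h : GaussSeq ι (x ++ ι a :: ι b :: (y ++ ι a :: ι b :: z))) :
    SeqHomotopic ι (x ++ ι a :: ι b :: (y ++ ι a :: ι b :: z)) (x ++ (y ++ z)) := by
  set s₀ := x ++ ι a :: ι b :: (y ++ ι a :: ι b :: z) with hs₀
  obtain ⟨P, hP⟩ := exists_fresh hι s₀
  obtain ⟨Q, hQ⟩ := exists_fresh hι (ι P :: s₀)
  set s₁ := x ++ ι P :: ι Q :: ([ι a, ι b] ++ ι Q :: ι P :: (y ++ ι a :: ι b :: z)) with hs₁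
  have p₁ : s₁.Perm (ι Q :: ι Q :: ι P :: ι P :: s₀) := by
    refine List.perm_iff_count.2 fun c => ?_
    simp only [hs₀, hs₁, List.count_append, List.count_cons, List.count_nil]
    ring
  have g₁ : GaussSeq ι s₁ := h.insert₂ hP hQ p₁
  obtain ⟨R, hR⟩ := exists_fresh hι s₁
  obtain ⟨T, hT⟩ := exists_fresh hι (ι R :: s₁)
  have g₂ : GaussSeq ι ((x ++ [ι P]) ++ ι R :: ι T ::
      ((ι Q :: ι a :: ι b :: ι Q :: ι P :: y ++ [ι a, ι b]) ++ ι T :: ι R :: z)) := by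
    refine g₁.insert₂ hR hT (List.perm_iff_count.2 fun c => ?_)
    simp only [hs₁, List.count_append, List.count_cons, List.count_nil]
    ring
  have e₁ : SeqHomotopic ι s₁ s₀ := by simpa [hs₀, hs₁] using seqHomotopic_h2 g₁
  have e₂ := seqHomotopic_h2 g₂
  have g₂' : GaussSeq ι ((x ++ [ι P, ι R]) ++ ι T :: ι Q :: ([ι a] ++ ι b :: ι Q ::
      ((ι P :: y ++ [ι a]) ++ ι b :: ι T :: (ι R :: z)))) := by
    simpa using g₂
  have e₃ := seqHomotopic_h3_symm g₂'
  have g₃ : GaussSeq ι ((x ++ [ι P, ι R, ι Q]) ++ ι T :: ι a ::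
      ((ι Q :: ι b :: ι P :: y) ++ ι a :: ι T :: (ι b :: ι R :: z))) := by
    refine g₂'.perm (List.perm_iff_count.2 fun c => ?_)
    simp only [List.count_append, List.count_cons, List.count_nil]
    ring
  have e₄ := seqHomotopic_h2 g₃
  have g₄ : GaussSeq ι ((x ++ [ι P, ι R]) ++ ι Q :: ι Q :: (ι b :: ι P :: y ++ ι b :: ι R :: z)) := by
    refine g₃.remove₂ (a := a) (b := T) (List.perm_iff_count.2 fun c => ?_)
    simp only [List.count_append, List.count_cons, List.count_nil]
    ring
  have e₅ := seqHomotopic_h1 g₄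
  have g₅ : GaussSeq ι ((x ++ [ι P]) ++ ι R :: ι b :: ((ι P :: y) ++ ι b :: ι R :: z)) := by
    refine g₄.remove (a := Q) (List.perm_iff_count.2 fun c => ?_)
    simp only [List.count_append, List.count_cons, List.count_nil]
    ring
  have e₆ := seqHomotopic_h2 g₅
  have g₆ : GaussSeq ι (x ++ ι P :: ι P :: (y ++ z)) := by
    refine g₅.remove₂ (a := R) (b := b) (List.perm_iff_count.2 fun c => ?_)
    simp only [List.count_append, List.count_cons, List.count_nil]
    ring
  have e₇ := seqHomotopic_h1 g₆
  simp only [List.append_assoc, List.cons_append, List.nil_append, hs₁]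
    at e₁ e₂ e₃ e₄ e₅ e₆ e₇
  exact e₁.symm.trans (e₂.symm.trans (e₃.trans (e₄.trans (e₅.trans (e₆.trans e₇)))))

/-- Renaming a letter to a fresh one is a consequence of the moves: insert `BC` after both
occurrences of `A`, and remove `AB`. -/
theorem seqHomotopic_rename (hι : ι.Injective) {a c : ℕ} {x y z : List S}
    (h : GaussSeq ι (x ++ ι a :: (y ++ ι a :: z))) (hc : ι c ∉ x ++ ι a :: (y ++ ι a :: z)) :
    SeqHomotopic ι (x ++ ι a :: (y ++ ι a :: z)) (x ++ ι c :: (y ++ ι c :: z)) := by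
  obtain ⟨b, hb⟩ := exists_fresh hι (ι c :: (x ++ ι a :: (y ++ ι a :: z)))
  have g₁ : GaussSeq ι ((x ++ [ι a]) ++ ι b :: ι c :: ((y ++ [ι a]) ++ ι b :: ι c :: z)) := by
    refine h.insert₂ hc hb (List.perm_iff_count.2 fun c => ?_)
    simp only [List.count_append, List.count_cons, List.count_nil]
    ring
  have e₁ := seqHomotopic_h2_parallel hι g₁
  have g₂ : GaussSeq ι (x ++ ι a :: ι b :: ((ι c :: y) ++ ι a :: ι b :: (ι c :: z))) := by
    simpa using g₁
  have e₂ := seqHomotopic_h2_parallel hι g₂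
  simp only [List.append_assoc, List.cons_append, List.nil_append] at e₁ e₂
  exact e₁.symm.trans e₂

/-- The form `xAByCAzCBt ↔ xBAyACzBCt` of H3. -/
theorem seqHomotopic_h3_second (hι : ι.Injective) {a b c : ℕ} {x y z t : List S}
    (h : GaussSeq ι (x ++ ι a :: ι b :: (y ++ ι c :: ι a :: (z ++ ι c :: ι b :: t)))) :
    SeqHomotopic ι (x ++ ι a :: ι b :: (y ++ ι c :: ι a :: (z ++ ι c :: ι b :: t)))
      (x ++ ι b :: ι a :: (y ++ ι a :: ι c :: (z ++ ι b :: ι c :: t))) := by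
  set s₀ := x ++ ι a :: ι b :: (y ++ ι c :: ι a :: (z ++ ι c :: ι b :: t)) with hs₀
  obtain ⟨d, hd⟩ := exists_fresh hι s₀
  obtain ⟨e, he⟩ := exists_fresh hι (ι d :: s₀)
  have g₁ : GaussSeq ι ((x ++ ι a :: ι b :: y ++ [ι c, ι a]) ++ ι d :: ι e ::
      ((z ++ [ι c, ι b]) ++ ι d :: ι e :: t)) := by
    refine h.insert₂ hd he (List.perm_iff_count.2 fun c => ?_)
    simp only [hs₀, List.count_append, List.count_cons, List.count_nil]
    ring
  have e₁ := seqHomotopic_h2_parallel hι g₁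
  have g₁' : GaussSeq ι (x ++ ι a :: ι b :: ((y ++ [ι c]) ++ ι a :: ι d ::
      ((ι e :: z ++ [ι c]) ++ ι b :: ι d :: (ι e :: t)))) := by
    simpa using g₁
  have e₂ := seqHomotopic_h3 g₁'
  have g₂ : GaussSeq ι ((x ++ ι b :: ι a :: y) ++ ι c :: ι d ::
      ((ι a :: ι e :: z) ++ ι c :: ι d :: (ι b :: ι e :: t))) := by
    refine g₁'.perm (List.perm_iff_count.2 fun c => ?_)
    simp only [List.count_append, List.count_cons, List.count_nil]
    ring
  have e₃ := seqHomotopic_h2_parallel hι g₂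
  have g₃ : GaussSeq ι ((x ++ ι b :: ι a :: y ++ [ι a]) ++ ι e :: ((z ++ [ι b]) ++ ι e :: t)) := by
    refine g₂.remove₂ (a := c) (b := d) (List.perm_iff_count.2 fun c => ?_)
    simp only [List.count_append, List.count_cons, List.count_nil]
    ring
  have hc : ι c ∉ (x ++ ι b :: ι a :: y ++ [ι a]) ++ ι e :: ((z ++ [ι b]) ++ ι e :: t) := by
    have := h c
    have hec : ι e ≠ ι c := fun q => he (by simp [hs₀, q])
    rw [← List.count_eq_zero]
    simp only [hs₀, List.count_append, List.count_cons, List.count_nil, beq_self_eq_true,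
      if_true, beq_iff_eq, hec, if_false] at this ⊢
    omega
  have e₄ := seqHomotopic_rename hι g₃ hc
  simp only [List.append_assoc, List.cons_append, List.nil_append] at e₁ e₂ e₃ e₄
  exact e₁.symm.trans (e₂.trans (e₃.trans e₄))

/-- The form `xAByACzCBt ↔ xBAyCAzBCt` of H3. -/
theorem seqHomotopic_h3_third (hι : ι.Injective) {a b c : ℕ} {x y z t : List S}
    (h : GaussSeq ι (x ++ ι a :: ι b :: (y ++ ι a :: ι c :: (z ++ ι c :: ι b :: t)))) :
    SeqHomotopic ι (x ++ ι a :: ι b :: (y ++ ι a :: ι c :: (z ++ ι c :: ι b :: t)))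
      (x ++ ι b :: ι a :: (y ++ ι c :: ι a :: (z ++ ι b :: ι c :: t))) := by
  set s₀ := x ++ ι a :: ι b :: (y ++ ι a :: ι c :: (z ++ ι c :: ι b :: t)) with hs₀
  obtain ⟨d, hd⟩ := exists_fresh hι s₀
  obtain ⟨e, he⟩ := exists_fresh hι (ι d :: s₀)
  have g₁ : GaussSeq ι ((x ++ [ι a, ι b]) ++ ι d :: ι e ::
      ((y ++ [ι a, ι c]) ++ ι d :: ι e :: (z ++ ι c :: ι b :: t))) := by
    refine h.insert₂ hd he (List.perm_iff_count.2 fun c => ?_)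
    simp only [hs₀, List.count_append, List.count_cons, List.count_nil]
    ring
  have e₁ := seqHomotopic_h2_parallel hι g₁
  have g₁' : GaussSeq ι ((x ++ [ι a]) ++ ι b :: ι d :: ((ι e :: y ++ [ι a]) ++ ι c :: ι d ::
      ((ι e :: z) ++ ι c :: ι b :: t))) := by
    simpa using g₁
  have e₂ := seqHomotopic_h3_symm g₁'
  have g₂ : GaussSeq ι (x ++ ι a :: ι d :: ((ι b :: ι e :: y) ++ ι a :: ι d ::
      (ι c :: ι e :: z ++ ι b :: ι c :: t))) := by
    refine g₁'.perm (List.perm_iff_count.2 fun c => ?_)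
    simp only [List.count_append, List.count_cons, List.count_nil]
    ring
  have e₃ := seqHomotopic_h2_parallel hι g₂
  have g₃ : GaussSeq ι ((x ++ [ι b]) ++ ι e :: ((y ++ [ι c]) ++ ι e :: (z ++ ι b :: ι c :: t))) := by
    refine g₂.remove₂ (a := a) (b := d) (List.perm_iff_count.2 fun c => ?_)
    simp only [List.count_append, List.count_cons, List.count_nil]
    ring
  have ha : ι a ∉ (x ++ [ι b]) ++ ι e :: ((y ++ [ι c]) ++ ι e :: (z ++ ι b :: ι c :: t)) := by
    have := h a
    have hea : ι e ≠ ι a := fun q => he (by simp [hs₀, q])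
    rw [← List.count_eq_zero]
    simp only [hs₀, List.count_append, List.count_cons, List.count_nil, beq_self_eq_true,
      if_true, beq_iff_eq, hea, if_false] at this ⊢
    omega
  have e₄ := seqHomotopic_rename hι g₃ ha
  simp only [List.append_assoc, List.cons_append, List.nil_append] at e₁ e₂ e₃ e₄
  exact e₁.symm.trans (e₂.trans (e₃.trans e₄))

end Sequences

/-! ### Phrases as sequences of symbols -/

theorem symbols_inj {p q : List ℕ × List ℕ} (h : symbols p = symbols q) : p = q := by
  obtain ⟨u, v⟩ := p
  obtain ⟨u', v'⟩ := q
  simp only [symbols, List.append_assoc, List.cons_append, List.nil_append] at h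
  have key : ∀ l m l' m' : List ℕ,
      l.map some ++ none :: m.map some = l'.map some ++ none :: m'.map some → l = l' ∧ m = m' := by
    intro l m l' m' e
    induction l generalizing l' with
    | nil =>
      cases l' with
      | nil => simpa [(Option.some_injective ℕ).list_map.eq_iff] using e
      | cons b l' => simp at e
    | cons a l ih =>
      cases l' with
      | nil => simp at e
      | cons b l' =>
        simp only [List.map_cons, List.cons_append, List.cons.injEq, Option.some.injEq] at e
        obtain ⟨rfl, rfl⟩ := ih l' e.2
        simp [e.1]
  obtain ⟨rfl, rfl⟩ := key _ _ _ _ h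
  rfl

theorem exists_map_some {s : List (Option ℕ)} (h : s.count none = 0) :
    ∃ l : List ℕ, s = l.map some := by
  induction s with
  | nil => exact ⟨[], rfl⟩
  | cons a s ih =>
    cases a with
    | none => simp at h
    | some a =>
      obtain ⟨l, rfl⟩ := ih (by simpa using h)
      exact ⟨a :: l, rfl⟩

theorem exists_symbols {s : List (Option ℕ)} (h : s.count none = 1) :
    ∃ u v : List ℕ, s = u.map some ++ none :: v.map some := by
  obtain ⟨l, r, rfl, hl⟩ := List.eq_append_cons_of_mem
    (List.count_pos_iff.1 (by omega : 0 < s.count none))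
  have h0 := List.count_eq_zero_of_not_mem hl
  obtain ⟨u, rfl⟩ := exists_map_some h0
  obtain ⟨v, rfl⟩ := exists_map_some (s := r) (by simpa [h0] using h)
  exact ⟨u, v, rfl⟩

theorem count_none_map_some (l : List ℕ) : (l.map some).count none = 0 :=
  List.count_eq_zero.2 (by simp)

theorem count_none_symbols (p : List ℕ × List ℕ) : (symbols p).count none = 1 := by
  simp [symbols, count_none_map_some]

theorem count_symbols [BEq (Option ℕ)] [LawfulBEq (Option ℕ)] (p : List ℕ × List ℕ) (a : ℕ) :
    (symbols p).count (some a) = (p.1 ++ p.2).count a := by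
  simp [symbols, List.count_map_of_injective _ _ (Option.some_injective ℕ)]

theorem isGauss_iff_gaussSeq {w : List ℕ} : IsGauss w ↔ GaussSeq id w := by
  refine ⟨fun h a => ?_, fun h a ha => ?_⟩
  · by_cases ha : a ∈ w
    · exact Or.inr (h a ha)
    · exact Or.inl (List.count_eq_zero_of_not_mem ha)
  · have := List.count_pos_iff.2 ha
    have := h a
    simp only [id] at this
    omega

theorem isGauss_iff_gaussSeq_symbols {p : List ℕ × List ℕ} :
    IsGauss (p.1 ++ p.2) ↔ GaussSeq some (symbols p) := by
  simp only [isGauss_iff_gaussSeq, GaussSeq, count_symbols, id]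

theorem HMove.count_none {s t : List (Option ℕ)} (h : HMove some s t) :
    s.count none = t.count none := by
  cases h <;> simp

/-- Sequences with one separator that are related by H1, H2, H3 spell mixed homotopic phrases. -/
theorem mixedClass_eq_of_seqHomotopic {p q : GaussPhrase}
    (h : SeqHomotopic some (symbols p.1) (symbols q.1)) : mixedClass p = mixedClass q := by
  have lift : ∀ t : List (Option ℕ), GaussSeq some t →
      ((∃ q : GaussPhrase, symbols q.1 = t) ↔ t.count none = 1) := by
    refine fun t hG => ⟨?_, fun ht => ?_⟩
    · rintro ⟨q, rfl⟩
      exact count_none_symbols q.1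
    · obtain ⟨u, v, rfl⟩ := exists_symbols ht
      exact ⟨⟨(u, v), isGauss_iff_gaussSeq_symbols.2 (by simpa [symbols] using hG)⟩,
        by simp [symbols]⟩
  refine h.of_spelling (F := fun p : GaussPhrase => symbols p.1)
    (R := fun p q => mixedClass p = mixedClass q) (fun p q e => Subtype.ext (symbols_inj e))
    ⟨fun _ => rfl, Eq.symm, Eq.trans⟩ (fun p q hm => ?_) fun s t hs ht hm => ?_
  · exact Quotient.sound (Relation.EqvGen.rel _ _ (Or.inr (Or.inl hm)))
  · rw [lift s hs, lift t ht, hm.count_none]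

theorem mixedClass_eq_of_shift {p q : GaussPhrase} {A : ℕ} {x v : List ℕ}
    (hp : p.1 = (A :: x, v)) (hq : q.1 = (x ++ [A], v)) : mixedClass p = mixedClass q := by
  refine Quotient.sound (Relation.EqvGen.rel _ _ (Or.inr (Or.inr ?_)))
  rw [hp, hq]
  exact ShiftFirst.shift A x v

theorem mixedClass_eq_of_map {p q : GaussPhrase} {f : ℕ → ℕ}
    (hf : Set.InjOn f {a | a ∈ p.1.1 ++ p.1.2})
    (h : q.1 = (p.1.1.map f, p.1.2.map f)) : mixedClass p = mixedClass q := by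
  refine Quotient.sound (Relation.EqvGen.rel _ _ (Or.inl ⟨f, ?_, by rw [h], by rw [h]⟩))
  convert hf.bijOn_image using 1
  ext a
  simp only [h, ← List.map_append, List.mem_map, Set.mem_image, Set.mem_ofPred_eq]

/-! ### An invariant of mixed homotopy with values in the dihedral group of order 8 -/

/-- The generator attached to a letter `a` of the second component of a phrase with first
component `u`: one reflection if `a` also appears in `u`, a neighbouring reflection if not. -/
def letterReflection (u : List ℕ) (a : ℕ) : DihedralGroup 4 :=
  if a ∈ u then .sr 0 else .sr 1

/-- The product of the reflections attached to the letters of the second component, in order. -/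
def dihedralInvariant (p : List ℕ × List ℕ) : DihedralGroup 4 :=
  (p.2.map (letterReflection p.1)).prod

theorem letterReflection_of_mem {u : List ℕ} {a : ℕ} (h : a ∈ u) :
    letterReflection u a = .sr 0 := if_pos h

theorem letterReflection_of_notMem {u : List ℕ} {a : ℕ} (h : a ∉ u) :
    letterReflection u a = .sr 1 := if_neg h

theorem map_letterReflection_congr {u u' l : List ℕ} (h : ∀ a ∈ l, a ∈ u ↔ a ∈ u') :
    l.map (letterReflection u) = l.map (letterReflection u') :=
  List.map_congr_left fun a ha => by simp only [letterReflection, h a ha]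

theorem eq_of_symbols_eq {p : List ℕ × List ℕ} {u v : List ℕ}
    (h : symbols p = u.map some ++ none :: v.map some) : p = (u, v) :=
  symbols_inj (by simpa [symbols] using h)

theorem sr_mul_sr_cancel (i : ZMod 4) (g : DihedralGroup 4) :
    DihedralGroup.sr i * (DihedralGroup.sr i * g) = g := by
  simp [← mul_assoc, DihedralGroup.sr_mul_sr]

/-- The commutator of the two reflections is central and has order two, so that exchanging them
at two places does not change a product. -/
theorem sr_exchange_twice (g k : DihedralGroup 4) :
    DihedralGroup.sr 0 * (.sr 1 * (g * (.sr 0 * (.sr 1 * k)))) =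
      DihedralGroup.sr 1 * (.sr 0 * (g * (.sr 1 * (.sr 0 * k)))) := by
  have : ∀ g : DihedralGroup 4, DihedralGroup.sr 0 * .sr 1 * g * .sr 0 * .sr 1 =
      DihedralGroup.sr 1 * .sr 0 * g * .sr 1 * .sr 0 := by decide
  simpa only [mul_assoc] using congrArg (· * k) (this g)

theorem dihedralInvariant_eq_of_hMove {p q : List ℕ × List ℕ} (hp : IsGauss (p.1 ++ p.2))
    (h : HMove some (symbols p) (symbols q)) : dihedralInvariant p = dihedralInvariant q := by
  have hcount : (symbols p).count none = 1 := count_none_symbols p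
  rw [isGauss_iff_gaussSeq] at hp
  generalize hs : symbols p = s at h hcount
  generalize ht : symbols q = t at h
  cases h with
  | h1 A x y =>
    simp only [List.count_append, List.count_cons, List.count_nil, reduceCtorEq, beq_iff_eq,
      if_false, add_zero] at hcount
    obtain ⟨hx, hy⟩ | ⟨hx, hy⟩ : (x.count none = 1 ∧ y.count none = 0) ∨
      (x.count none = 0 ∧ y.count none = 1) := by omega
    · obtain ⟨u, x, rfl⟩ := exists_symbols hx
      obtain ⟨y, rfl⟩ := exists_map_some hy
      obtain rfl := eq_of_symbols_eq (p := p) (u := u) (v := x ++ A :: A :: y) (by simp [hs])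
      obtain rfl := eq_of_symbols_eq (p := q) (u := u) (v := x ++ y) (by simp [ht])
      by_cases hA : A ∈ u <;> simp [dihedralInvariant, letterReflection, hA, sr_mul_sr_cancel]
    · obtain ⟨x, rfl⟩ := exists_map_some hx
      obtain ⟨y, v, rfl⟩ := exists_symbols hy
      obtain rfl := eq_of_symbols_eq (p := p) (u := x ++ A :: A :: y) (v := v) (by simp [hs])
      obtain rfl := eq_of_symbols_eq (p := q) (u := x ++ y) (v := v) (by simp [ht])
      have hA := hp A
      simp only [id, List.count_append, List.count_cons_self] at hA
      have hv : A ∉ v := List.count_eq_zero.1 (by omega)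
      exact congrArg List.prod (map_letterReflection_congr fun a ha => by
        have : a ≠ A := by rintro rfl; exact hv ha
        simp [this])
  | h2 A B x y z =>
    simp only [List.count_append, List.count_cons, List.count_nil, reduceCtorEq, beq_iff_eq,
      if_false, add_zero] at hcount
    have hA := hp A
    have hB := hp B
    obtain ⟨hx, hy, hz⟩ | ⟨hx, hy, hz⟩ | ⟨hx, hy, hz⟩ :
      (x.count none = 1 ∧ y.count none = 0 ∧ z.count none = 0) ∨
      (x.count none = 0 ∧ y.count none = 1 ∧ z.count none = 0) ∨
      (x.count none = 0 ∧ y.count none = 0 ∧ z.count none = 1) := by omega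
    · obtain ⟨u, x, rfl⟩ := exists_symbols hx
      obtain ⟨y, rfl⟩ := exists_map_some hy
      obtain ⟨z, rfl⟩ := exists_map_some hz
      obtain rfl := eq_of_symbols_eq (p := p) (u := u)
        (v := x ++ A :: B :: (y ++ B :: A :: z)) (by simp [hs])
      obtain rfl := eq_of_symbols_eq (p := q) (u := u) (v := x ++ (y ++ z)) (by simp [ht])
      simp only [id, List.count_append, List.count_cons, beq_self_eq_true, if_true] at hA hB
      have hA : A ∉ u := List.count_eq_zero.1 (by omega)
      have hB : B ∉ u := List.count_eq_zero.1 (by omega)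
      simp [dihedralInvariant, letterReflection_of_notMem hA, letterReflection_of_notMem hB,
        sr_mul_sr_cancel]
    · obtain ⟨x, rfl⟩ := exists_map_some hx
      obtain ⟨y, v, rfl⟩ := exists_symbols hy
      obtain ⟨z, rfl⟩ := exists_map_some hz
      obtain rfl := eq_of_symbols_eq (p := p) (u := x ++ A :: B :: y)
        (v := v ++ B :: A :: z) (by simp [hs])
      obtain rfl := eq_of_symbols_eq (p := q) (u := x ++ y) (v := v ++ z) (by simp [ht])
      simp only [id, List.count_append, List.count_cons, beq_self_eq_true, if_true] at hA hB
      have hA : A ∉ v ++ z := List.count_eq_zero.1 (by rw [List.count_append]; omega)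
      have hB : B ∉ v ++ z := List.count_eq_zero.1 (by rw [List.count_append]; omega)
      have e : (v ++ z).map (letterReflection (x ++ A :: B :: y)) =
          (v ++ z).map (letterReflection (x ++ y)) :=
        map_letterReflection_congr fun a ha => by
          have h₁ : a ≠ A := by rintro rfl; exact hA ha
          have h₂ : a ≠ B := by rintro rfl; exact hB ha
          simp [h₁, h₂]
      rw [dihedralInvariant, dihedralInvariant, ← e]
      simp [letterReflection_of_mem, sr_mul_sr_cancel]
    · obtain ⟨x, rfl⟩ := exists_map_some hx
      obtain ⟨y, rfl⟩ := exists_map_some hy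
      obtain ⟨z, v, rfl⟩ := exists_symbols hz
      obtain rfl := eq_of_symbols_eq (p := p) (u := x ++ A :: B :: (y ++ B :: A :: z))
        (v := v) (by simp [hs])
      obtain rfl := eq_of_symbols_eq (p := q) (u := x ++ (y ++ z)) (v := v) (by simp [ht])
      simp only [id, List.count_append, List.count_cons, beq_self_eq_true, if_true] at hA hB
      have hA : A ∉ v := List.count_eq_zero.1 (by omega)
      have hB : B ∉ v := List.count_eq_zero.1 (by omega)
      exact congrArg List.prod (map_letterReflection_congr fun a ha => by
        have h₁ : a ≠ A := by rintro rfl; exact hA ha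
        have h₂ : a ≠ B := by rintro rfl; exact hB ha
        simp [h₁, h₂])
  | h3 A B C x y z t =>
    simp only [List.count_append, List.count_cons, List.count_nil, reduceCtorEq, beq_iff_eq,
      if_false, add_zero] at hcount
    have hA := hp A
    have hB := hp B
    have hC := hp C
    obtain ⟨hx, hy, hz, ht'⟩ | ⟨hx, hy, hz, ht'⟩ | ⟨hx, hy, hz, ht'⟩ | ⟨hx, hy, hz, ht'⟩ :
      (x.count none = 1 ∧ y.count none = 0 ∧ z.count none = 0 ∧ t.count none = 0) ∨
      (x.count none = 0 ∧ y.count none = 1 ∧ z.count none = 0 ∧ t.count none = 0) ∨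
      (x.count none = 0 ∧ y.count none = 0 ∧ z.count none = 1 ∧ t.count none = 0) ∨
      (x.count none = 0 ∧ y.count none = 0 ∧ z.count none = 0 ∧ t.count none = 1) := by omega
    · obtain ⟨u, x, rfl⟩ := exists_symbols hx
      obtain ⟨y, rfl⟩ := exists_map_some hy
      obtain ⟨z, rfl⟩ := exists_map_some hz
      obtain ⟨t, rfl⟩ := exists_map_some ht'
      obtain rfl := eq_of_symbols_eq (p := p) (u := u)
        (v := x ++ A :: B :: (y ++ A :: C :: (z ++ B :: C :: t))) (by simp [hs])
      obtain rfl := eq_of_symbols_eq (p := q) (u := u)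
        (v := x ++ B :: A :: (y ++ C :: A :: (z ++ C :: B :: t))) (by simp [ht])
      simp only [id, List.count_append, List.count_cons, beq_self_eq_true, if_true] at hA hB hC
      have hA : A ∉ u := List.count_eq_zero.1 (by omega)
      have hB : B ∉ u := List.count_eq_zero.1 (by omega)
      have hC : C ∉ u := List.count_eq_zero.1 (by omega)
      simp [dihedralInvariant, letterReflection_of_notMem hA, letterReflection_of_notMem hB,
        letterReflection_of_notMem hC]
    · obtain ⟨x, rfl⟩ := exists_map_some hx
      obtain ⟨y, v, rfl⟩ := exists_symbols hy
      obtain ⟨z, rfl⟩ := exists_map_some hz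
      obtain ⟨t, rfl⟩ := exists_map_some ht'
      obtain rfl := eq_of_symbols_eq (p := p) (u := x ++ A :: B :: y)
        (v := v ++ A :: C :: (z ++ B :: C :: t)) (by simp [hs])
      obtain rfl := eq_of_symbols_eq (p := q) (u := x ++ B :: A :: y)
        (v := v ++ C :: A :: (z ++ C :: B :: t)) (by simp [ht])
      have e : letterReflection (x ++ B :: A :: y) = letterReflection (x ++ A :: B :: y) := by
        funext a
        simp only [letterReflection, List.mem_append, List.mem_cons, or_left_comm]
      simp only [id, List.count_append, List.count_cons, beq_self_eq_true, if_true] at hA hB hC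
      have hC : C ∉ x ++ A :: B :: y :=
        List.count_eq_zero.1 (by simp only [List.count_append, List.count_cons]; omega)
      rw [dihedralInvariant, dihedralInvariant, e]
      simp [letterReflection_of_mem, letterReflection_of_notMem hC, sr_exchange_twice]
    · obtain ⟨x, rfl⟩ := exists_map_some hx
      obtain ⟨y, rfl⟩ := exists_map_some hy
      obtain ⟨z, v, rfl⟩ := exists_symbols hz
      obtain ⟨t, rfl⟩ := exists_map_some ht'
      obtain rfl := eq_of_symbols_eq (p := p) (u := x ++ A :: B :: (y ++ A :: C :: z))
        (v := v ++ B :: C :: t) (by simp [hs])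
      obtain rfl := eq_of_symbols_eq (p := q) (u := x ++ B :: A :: (y ++ C :: A :: z))
        (v := v ++ C :: B :: t) (by simp [ht])
      have e : letterReflection (x ++ B :: A :: (y ++ C :: A :: z)) =
          letterReflection (x ++ A :: B :: (y ++ A :: C :: z)) := by
        funext a
        simp only [letterReflection, List.mem_append, List.mem_cons, or_left_comm]
      rw [dihedralInvariant, dihedralInvariant, e]
      simp [letterReflection_of_mem]
    · obtain ⟨x, rfl⟩ := exists_map_some hx
      obtain ⟨y, rfl⟩ := exists_map_some hy
      obtain ⟨z, rfl⟩ := exists_map_some hz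
      obtain ⟨t, v, rfl⟩ := exists_symbols ht'
      obtain rfl := eq_of_symbols_eq (p := p) (u := x ++ A :: B :: (y ++ A :: C :: (z ++ B :: C :: t)))
        (v := v) (by simp [hs])
      obtain rfl := eq_of_symbols_eq (p := q) (u := x ++ B :: A :: (y ++ C :: A :: (z ++ C :: B :: t)))
        (v := v) (by simp [ht])
      exact congrArg List.prod (map_letterReflection_congr fun a _ => by
        simp only [List.mem_append, List.mem_cons, or_left_comm])

theorem dihedralInvariant_eq_of_mixedStep {p q : GaussPhrase} (h : MixedStep p q) :
    dihedralInvariant p.1 = dihedralInvariant q.1 := by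
  obtain ⟨f, hf, h₁, h₂⟩ | h | h := h
  · rw [dihedralInvariant, dihedralInvariant, ← h₁, ← h₂, List.map_map]
    congr 1
    refine List.map_congr_left fun a ha => ?_
    have : a ∈ p.1.1 ↔ f a ∈ p.1.1.map f := by
      refine ⟨List.mem_map_of_mem, fun h => ?_⟩
      obtain ⟨b, hb, e⟩ := List.mem_map.1 h
      rwa [← hf.injOn (List.mem_append_left _ hb) (List.mem_append_right _ ha) e]
    simp only [letterReflection, Function.comp, this]
  · exact dihedralInvariant_eq_of_hMove p.2 h
  · generalize p.1 = p at h
    generalize q.1 = q at h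
    cases h with
    | shift A x v =>
      exact congrArg List.prod (map_letterReflection_congr fun a _ => by simp [or_comm])

theorem dihedralInvariant_eq_of_mixedClass_eq {p q : GaussPhrase}
    (h : mixedClass p = mixedClass q) : dihedralInvariant p.1 = dihedralInvariant q.1 := by
  replace h : Relation.EqvGen MixedStep p q := Quotient.exact h
  induction h with
  | rel _ _ h => exact dihedralInvariant_eq_of_mixedStep h
  | refl _ => rfl
  | symm _ _ _ ih => exact ih.symm
  | trans _ _ _ _ _ ih₁ ih₂ => exact ih₁.trans ih₂

theorem mixedClass_nodup :
    [mixedClass phraseA, mixedClass phraseB, mixedClass phraseC, mixedClass phraseD].Nodup := by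
  have hne : ∀ p q : GaussPhrase, dihedralInvariant p.1 ≠ dihedralInvariant q.1 →
      mixedClass p ≠ mixedClass q := fun p q h e => h (dihedralInvariant_eq_of_mixedClass_eq e)
  simp only [List.nodup_cons, List.mem_cons, List.not_mem_nil, not_or, or_false, not_false_eq_true,
    List.nodup_nil, and_true]
  refine ⟨⟨hne _ _ ?_, hne _ _ ?_, hne _ _ ?_⟩, ⟨hne _ _ ?_, hne _ _ ?_⟩, hne _ _ ?_⟩ <;> decide

/-! ### Splitting a word at a letter untouched by a move -/

theorem exists_of_count_eq_one {l : List ℕ} {D : ℕ} (h : l.count D = 1) :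
    ∃ l₁ l₂, l = l₁ ++ D :: l₂ ∧ D ∉ l₁ ∧ D ∉ l₂ := by
  obtain ⟨l₁, l₂, rfl, h₁⟩ := List.eq_append_cons_of_mem
    (List.count_pos_iff.1 (by omega : 0 < l.count D))
  refine ⟨l₁, l₂, rfl, h₁, List.count_eq_zero.1 ?_⟩
  rw [List.count_append, List.count_cons_self] at h
  omega

theorem exists_of_count_eq_two {l : List ℕ} {D : ℕ} (h : l.count D = 2) :
    ∃ l₁ l₂ l₃, l = l₁ ++ D :: (l₂ ++ D :: l₃) ∧ D ∉ l₁ ∧ D ∉ l₂ ∧ D ∉ l₃ := by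
  obtain ⟨x, y, z, hx, hy, hz, rfl⟩ := exists_split l D h
  exact ⟨x, y, z, by simp, hx, hy, hz⟩

theorem split_append_cons {w x y z : List ℕ} {D : ℕ} (h : w = x ++ D :: (y ++ D :: z))
    (hx : D ∉ x) (hy : D ∉ y) : split w D = (y, x ++ z) := by
  rw [h, ← split_eq D x y z hx hy]
  simp

theorem symbols_split {w x y z : List ℕ} {D : ℕ} (h : w = x ++ D :: (y ++ D :: z))
    (hx : D ∉ x) (hy : D ∉ y) :
    symbols (split w D) = y.map some ++ none :: (x.map some ++ z.map some) := by
  simp [split_append_cons h hx hy, symbols]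

theorem gaussSeq_symbols_split {w : List ℕ} {D : ℕ} (hw : IsGauss w) (hD : D ∈ w) :
    GaussSeq some (symbols (split w D)) :=
  isGauss_iff_gaussSeq_symbols.1 (split_isGauss ⟨w, hw⟩ D hD)

theorem seqHomotopic_split_h1 {x y : List ℕ} {a D : ℕ} (hu : IsGauss (x ++ a :: a :: y))
    (hD : D ∈ x ++ a :: a :: y) (ha : D ≠ a) :
    SeqHomotopic some (symbols (split (x ++ a :: a :: y) D)) (symbols (split (x ++ y) D)) := by
  have hG := gaussSeq_symbols_split hu hD
  have hc := hu D hD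
  clear hu hD
  simp only [List.count_append, List.count_cons_of_ne ha.symm] at hc
  obtain ⟨hx, hy⟩ | ⟨hx, hy⟩ | ⟨hx, hy⟩ :
    (x.count D = 2 ∧ y.count D = 0) ∨ (x.count D = 0 ∧ y.count D = 2) ∨
    (x.count D = 1 ∧ y.count D = 1) := by omega
  all_goals clear hc
  · obtain ⟨x₁, x₂, x₃, rfl, h₁, h₂, h₃⟩ := exists_of_count_eq_two hx
    rw [symbols_split (x := x₁) (y := x₂) (z := x₃ ++ a :: a :: y)
      (by simp) (by simp [*]) (by simp [*])] at hG ⊢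
    rw [symbols_split (x := x₁) (y := x₂) (z := x₃ ++ y) (by simp) (by simp [*]) (by simp [*])]
    simpa using seqHomotopic_h1 (ι := some) (a := a)
      (x := x₂.map some ++ none :: (x₁.map some ++ x₃.map some))
      (y := y.map some) (by simpa using hG)
  · obtain ⟨y₁, y₂, y₃, rfl, h₁, h₂, h₃⟩ := exists_of_count_eq_two hy
    have hx := List.count_eq_zero.1 hx
    rw [symbols_split (x := x ++ a :: a :: y₁) (y := y₂) (z := y₃)
      (by simp) (by simp [*]) (by simp [*])] at hG ⊢
    rw [symbols_split (x := x ++ y₁) (y := y₂) (z := y₃) (by simp) (by simp [*]) (by simp [*])]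
    simpa using seqHomotopic_h1 (ι := some) (a := a)
      (x := y₂.map some ++ none :: x.map some)
      (y := y₁.map some ++ y₃.map some) (by simpa using hG)
  · obtain ⟨x₁, x₂, rfl, h₁, h₂⟩ := exists_of_count_eq_one hx
    obtain ⟨y₁, y₂, rfl, h₃, h₄⟩ := exists_of_count_eq_one hy
    rw [symbols_split (x := x₁) (y := x₂ ++ a :: a :: y₁) (z := y₂)
      (by simp) (by simp [*]) (by simp [*])] at hG ⊢
    rw [symbols_split (x := x₁) (y := x₂ ++ y₁) (z := y₂) (by simp) (by simp [*]) (by simp [*])]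
    simpa using seqHomotopic_h1 (ι := some) (a := a)
      (x := x₂.map some) (y := y₁.map some ++ none :: (x₁.map some ++ y₂.map some))
      (by simpa using hG)

theorem seqHomotopic_split_h2 {x y z : List ℕ} {a b D : ℕ}
    (hu : IsGauss (x ++ a :: b :: (y ++ b :: a :: z)))
    (hD : D ∈ x ++ a :: b :: (y ++ b :: a :: z)) (ha : D ≠ a) (hb : D ≠ b) :
    SeqHomotopic some (symbols (split (x ++ a :: b :: (y ++ b :: a :: z)) D))
      (symbols (split (x ++ (y ++ z)) D)) := by
  have hG := gaussSeq_symbols_split hu hD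
  have hc := hu D hD
  clear hu hD
  simp only [List.count_append, List.count_cons_of_ne ha.symm, List.count_cons_of_ne hb.symm] at hc
  obtain ⟨hx, hy, hz⟩ | ⟨hx, hy, hz⟩ | ⟨hx, hy, hz⟩ | ⟨hx, hy, hz⟩ | ⟨hx, hy, hz⟩ | ⟨hx, hy, hz⟩ :
    (x.count D = 2 ∧ y.count D = 0 ∧ z.count D = 0) ∨
    (x.count D = 0 ∧ y.count D = 2 ∧ z.count D = 0) ∨
    (x.count D = 0 ∧ y.count D = 0 ∧ z.count D = 2) ∨
    (x.count D = 1 ∧ y.count D = 1 ∧ z.count D = 0) ∨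
    (x.count D = 1 ∧ y.count D = 0 ∧ z.count D = 1) ∨
    (x.count D = 0 ∧ y.count D = 1 ∧ z.count D = 1) := by omega
  all_goals clear hc
  · obtain ⟨x₁, x₂, x₃, rfl, h₁, h₂, h₃⟩ := exists_of_count_eq_two hx
    rw [symbols_split (x := x₁) (y := x₂) (z := x₃ ++ a :: b :: (y ++ b :: a :: z))
      (by simp) (by simp [*]) (by simp [*])] at hG ⊢
    rw [symbols_split (x := x₁) (y := x₂) (z := x₃ ++ (y ++ z))
      (by simp) (by simp [*]) (by simp [*])]
    simpa using seqHomotopic_h2 (ι := some) (a := a) (b := b)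
      (x := x₂.map some ++ none :: (x₁.map some ++ x₃.map some))
      (y := y.map some) (z := z.map some) (by simpa using hG)
  · obtain ⟨y₁, y₂, y₃, rfl, h₁, h₂, h₃⟩ := exists_of_count_eq_two hy
    have hx := List.count_eq_zero.1 hx
    rw [symbols_split (x := x ++ a :: b :: y₁) (y := y₂) (z := y₃ ++ b :: a :: z)
      (by simp) (by simp [*]) (by simp [*])] at hG ⊢
    rw [symbols_split (x := x ++ y₁) (y := y₂) (z := y₃ ++ z)
      (by simp) (by simp [*]) (by simp [*])]
    simpa using seqHomotopic_h2 (ι := some) (a := a) (b := b)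
      (x := y₂.map some ++ none :: x.map some)
      (y := y₁.map some ++ y₃.map some) (z := z.map some) (by simpa using hG)
  · obtain ⟨z₁, z₂, z₃, rfl, h₁, h₂, h₃⟩ := exists_of_count_eq_two hz
    have hx := List.count_eq_zero.1 hx
    have hy := List.count_eq_zero.1 hy
    rw [symbols_split (x := x ++ a :: b :: (y ++ b :: a :: z₁)) (y := z₂) (z := z₃)
      (by simp) (by simp [*]) (by simp [*])] at hG ⊢
    rw [symbols_split (x := x ++ (y ++ z₁)) (y := z₂) (z := z₃)
      (by simp) (by simp [*]) (by simp [*])]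
    simpa using seqHomotopic_h2 (ι := some) (a := a) (b := b)
      (x := z₂.map some ++ none :: x.map some)
      (y := y.map some) (z := z₁.map some ++ z₃.map some) (by simpa using hG)
  · obtain ⟨x₁, x₂, rfl, h₁, h₂⟩ := exists_of_count_eq_one hx
    obtain ⟨y₁, y₂, rfl, h₃, h₄⟩ := exists_of_count_eq_one hy
    rw [symbols_split (x := x₁) (y := x₂ ++ a :: b :: y₁) (z := y₂ ++ b :: a :: z)
      (by simp) (by simp [*]) (by simp [*])] at hG ⊢
    rw [symbols_split (x := x₁) (y := x₂ ++ y₁) (z := y₂ ++ z)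
      (by simp) (by simp [*]) (by simp [*])]
    simpa using seqHomotopic_h2 (ι := some) (a := a) (b := b) (x := x₂.map some)
      (y := y₁.map some ++ none :: (x₁.map some ++ y₂.map some)) (z := z.map some)
      (by simpa using hG)
  · obtain ⟨x₁, x₂, rfl, h₁, h₂⟩ := exists_of_count_eq_one hx
    obtain ⟨z₁, z₂, rfl, h₃, h₄⟩ := exists_of_count_eq_one hz
    have hy := List.count_eq_zero.1 hy
    rw [symbols_split (x := x₁) (y := x₂ ++ a :: b :: (y ++ b :: a :: z₁)) (z := z₂)
      (by simp) (by simp [*]) (by simp [*])] at hG ⊢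
    rw [symbols_split (x := x₁) (y := x₂ ++ (y ++ z₁)) (z := z₂)
      (by simp) (by simp [*]) (by simp [*])]
    simpa using seqHomotopic_h2 (ι := some) (a := a) (b := b) (x := x₂.map some)
      (y := y.map some) (z := z₁.map some ++ none :: (x₁.map some ++ z₂.map some))
      (by simpa using hG)
  · obtain ⟨y₁, y₂, rfl, h₁, h₂⟩ := exists_of_count_eq_one hy
    obtain ⟨z₁, z₂, rfl, h₃, h₄⟩ := exists_of_count_eq_one hz
    have hx := List.count_eq_zero.1 hx
    rw [symbols_split (x := x ++ a :: b :: y₁) (y := y₂ ++ b :: a :: z₁) (z := z₂)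
      (by simp) (by simp [*]) (by simp [*])] at hG ⊢
    rw [symbols_split (x := x ++ y₁) (y := y₂ ++ z₁) (z := z₂)
      (by simp) (by simp [*]) (by simp [*])]
    -- The two pairs change places, so that H2 applies with its letters exchanged.
    simpa using seqHomotopic_h2 (ι := some) (a := b) (b := a) (x := y₂.map some)
      (y := z₁.map some ++ none :: x.map some) (z := y₁.map some ++ z₂.map some)
      (by simpa using hG)

theorem cases_of_add_eq_two {a b c d : ℕ} (h : a + (b + (c + d)) = 2) :
    (a = 2 ∧ b = 0 ∧ c = 0 ∧ d = 0) ∨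
    (a = 0 ∧ b = 2 ∧ c = 0 ∧ d = 0) ∨
    (a = 0 ∧ b = 0 ∧ c = 2 ∧ d = 0) ∨
    (a = 0 ∧ b = 0 ∧ c = 0 ∧ d = 2) ∨
    (a = 1 ∧ b = 1 ∧ c = 0 ∧ d = 0) ∨
    (a = 1 ∧ b = 0 ∧ c = 1 ∧ d = 0) ∨
    (a = 1 ∧ b = 0 ∧ c = 0 ∧ d = 1) ∨
    (a = 0 ∧ b = 1 ∧ c = 1 ∧ d = 0) ∨
    (a = 0 ∧ b = 1 ∧ c = 0 ∧ d = 1) ∨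
    (a = 0 ∧ b = 0 ∧ c = 1 ∧ d = 1) := by
  obtain rfl | rfl | rfl : a = 0 ∨ a = 1 ∨ a = 2 := by omega
  all_goals obtain rfl | rfl | rfl : b = 0 ∨ b = 1 ∨ b = 2 := by omega
  all_goals simp
  all_goals omega

/-- Splitting at a letter permutes the three pairs of an H3 move. Depending on the permutation,
the two phrases are related by H3 or by one of its derived forms. -/
theorem seqHomotopic_split_h3 {x y z t : List ℕ} {a b c D : ℕ}
    (hu : IsGauss (x ++ a :: b :: (y ++ a :: c :: (z ++ b :: c :: t))))
    (hD : D ∈ x ++ a :: b :: (y ++ a :: c :: (z ++ b :: c :: t)))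
    (ha : D ≠ a) (hb : D ≠ b) (hc : D ≠ c) :
    SeqHomotopic some (symbols (split (x ++ a :: b :: (y ++ a :: c :: (z ++ b :: c :: t))) D))
      (symbols (split (x ++ b :: a :: (y ++ c :: a :: (z ++ c :: b :: t))) D)) := by
  have hι := Option.some_injective ℕ
  have hG := gaussSeq_symbols_split hu hD
  have hG' : GaussSeq some
      (symbols (split (x ++ b :: a :: (y ++ c :: a :: (z ++ c :: b :: t))) D)) := by
    refine gaussSeq_symbols_split ?_ (by simpa [ha, hb, hc] using hD)
    rw [isGauss_iff_gaussSeq] at hu ⊢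
    refine hu.perm (List.perm_iff_count.2 fun c => ?_)
    simp only [List.count_append, List.count_cons]
    ring
  have hn := hu D hD
  clear hu hD
  simp only [List.count_append, List.count_cons_of_ne ha.symm, List.count_cons_of_ne hb.symm,
    List.count_cons_of_ne hc.symm] at hn
  obtain ⟨hx, hy, hz, ht⟩ | ⟨hx, hy, hz, ht⟩ | ⟨hx, hy, hz, ht⟩ | ⟨hx, hy, hz, ht⟩ |
      ⟨hx, hy, hz, ht⟩ | ⟨hx, hy, hz, ht⟩ | ⟨hx, hy, hz, ht⟩ | ⟨hx, hy, hz, ht⟩ |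
      ⟨hx, hy, hz, ht⟩ | ⟨hx, hy, hz, ht⟩ :
    (x.count D = 2 ∧ y.count D = 0 ∧ z.count D = 0 ∧ t.count D = 0) ∨
    (x.count D = 0 ∧ y.count D = 2 ∧ z.count D = 0 ∧ t.count D = 0) ∨
    (x.count D = 0 ∧ y.count D = 0 ∧ z.count D = 2 ∧ t.count D = 0) ∨
    (x.count D = 0 ∧ y.count D = 0 ∧ z.count D = 0 ∧ t.count D = 2) ∨
    (x.count D = 1 ∧ y.count D = 1 ∧ z.count D = 0 ∧ t.count D = 0) ∨
    (x.count D = 1 ∧ y.count D = 0 ∧ z.count D = 1 ∧ t.count D = 0) ∨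
    (x.count D = 1 ∧ y.count D = 0 ∧ z.count D = 0 ∧ t.count D = 1) ∨
    (x.count D = 0 ∧ y.count D = 1 ∧ z.count D = 1 ∧ t.count D = 0) ∨
    (x.count D = 0 ∧ y.count D = 1 ∧ z.count D = 0 ∧ t.count D = 1) ∨
    (x.count D = 0 ∧ y.count D = 0 ∧ z.count D = 1 ∧ t.count D = 1) :=
    cases_of_add_eq_two (by omega)
  all_goals clear hn
  · obtain ⟨x₁, x₂, x₃, rfl, h₁, h₂, h₃⟩ := exists_of_count_eq_two hx
    rw [symbols_split (x := x₁) (y := x₂) (z := x₃ ++ a :: b :: (y ++ a :: c :: (z ++ b :: c :: t)))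
      (by simp) (by simp [*]) (by simp [*])] at hG ⊢
    rw [symbols_split (x := x₁) (y := x₂) (z := x₃ ++ b :: a :: (y ++ c :: a :: (z ++ c :: b :: t)))
      (by simp) (by simp [*]) (by simp [*])]
    simpa using seqHomotopic_h3 (ι := some) (a := a) (b := b) (c := c)
      (x := x₂.map some ++ none :: (x₁.map some ++ x₃.map some))
      (y := y.map some) (z := z.map some) (t := t.map some) (by simpa using hG)
  · obtain ⟨y₁, y₂, y₃, rfl, h₁, h₂, h₃⟩ := exists_of_count_eq_two hy
    have hx := List.count_eq_zero.1 hx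
    rw [symbols_split (x := x ++ a :: b :: y₁) (y := y₂) (z := y₃ ++ a :: c :: (z ++ b :: c :: t))
      (by simp) (by simp [*]) (by simp [*])] at hG ⊢
    rw [symbols_split (x := x ++ b :: a :: y₁) (y := y₂) (z := y₃ ++ c :: a :: (z ++ c :: b :: t))
      (by simp) (by simp [*]) (by simp [*])]
    simpa using seqHomotopic_h3 (ι := some) (a := a) (b := b) (c := c)
      (x := y₂.map some ++ none :: x.map some)
      (y := y₁.map some ++ y₃.map some) (z := z.map some) (t := t.map some) (by simpa using hG)
  · obtain ⟨z₁, z₂, z₃, rfl, h₁, h₂, h₃⟩ := exists_of_count_eq_two hz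
    have hx := List.count_eq_zero.1 hx
    have hy := List.count_eq_zero.1 hy
    rw [symbols_split (x := x ++ a :: b :: (y ++ a :: c :: z₁)) (y := z₂) (z := z₃ ++ b :: c :: t)
      (by simp) (by simp [*]) (by simp [*])] at hG ⊢
    rw [symbols_split (x := x ++ b :: a :: (y ++ c :: a :: z₁)) (y := z₂) (z := z₃ ++ c :: b :: t)
      (by simp) (by simp [*]) (by simp [*])]
    simpa using seqHomotopic_h3 (ι := some) (a := a) (b := b) (c := c)
      (x := z₂.map some ++ none :: x.map some)
      (y := y.map some) (z := z₁.map some ++ z₃.map some) (t := t.map some) (by simpa using hG)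
  · obtain ⟨t₁, t₂, t₃, rfl, h₁, h₂, h₃⟩ := exists_of_count_eq_two ht
    have hx := List.count_eq_zero.1 hx
    have hy := List.count_eq_zero.1 hy
    have hz := List.count_eq_zero.1 hz
    rw [symbols_split (x := x ++ a :: b :: (y ++ a :: c :: (z ++ b :: c :: t₁))) (y := t₂) (z := t₃)
      (by simp) (by simp [*]) (by simp [*])] at hG ⊢
    rw [symbols_split (x := x ++ b :: a :: (y ++ c :: a :: (z ++ c :: b :: t₁))) (y := t₂) (z := t₃)
      (by simp) (by simp [*]) (by simp [*])]
    simpa using seqHomotopic_h3 (ι := some) (a := a) (b := b) (c := c)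
      (x := t₂.map some ++ none :: x.map some)
      (y := y.map some) (z := z.map some) (t := t₁.map some ++ t₃.map some) (by simpa using hG)
  · obtain ⟨x₁, x₂, rfl, h₁, h₂⟩ := exists_of_count_eq_one hx
    obtain ⟨y₁, y₂, rfl, h₃, h₄⟩ := exists_of_count_eq_one hy
    rw [symbols_split (x := x₁) (y := x₂ ++ a :: b :: y₁) (z := y₂ ++ a :: c :: (z ++ b :: c :: t))
      (by simp) (by simp [*]) (by simp [*])] at hG ⊢
    rw [symbols_split (x := x₁) (y := x₂ ++ b :: a :: y₁) (z := y₂ ++ c :: a :: (z ++ c :: b :: t))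
      (by simp) (by simp [*]) (by simp [*])]
    simpa using seqHomotopic_h3 (ι := some) (a := a) (b := b) (c := c) (x := x₂.map some)
      (y := y₁.map some ++ none :: (x₁.map some ++ y₂.map some)) (z := z.map some)
      (t := t.map some) (by simpa using hG)
  · obtain ⟨x₁, x₂, rfl, h₁, h₂⟩ := exists_of_count_eq_one hx
    obtain ⟨z₁, z₂, rfl, h₃, h₄⟩ := exists_of_count_eq_one hz
    have hy := List.count_eq_zero.1 hy
    rw [symbols_split (x := x₁) (y := x₂ ++ a :: b :: (y ++ a :: c :: z₁)) (z := z₂ ++ b :: c :: t)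
      (by simp) (by simp [*]) (by simp [*])] at hG ⊢
    rw [symbols_split (x := x₁) (y := x₂ ++ b :: a :: (y ++ c :: a :: z₁)) (z := z₂ ++ c :: b :: t)
      (by simp) (by simp [*]) (by simp [*])]
    simpa using seqHomotopic_h3 (ι := some) (a := a) (b := b) (c := c) (x := x₂.map some)
      (y := y.map some) (z := z₁.map some ++ none :: (x₁.map some ++ z₂.map some))
      (t := t.map some) (by simpa using hG)
  · obtain ⟨x₁, x₂, rfl, h₁, h₂⟩ := exists_of_count_eq_one hx
    obtain ⟨t₁, t₂, rfl, h₃, h₄⟩ := exists_of_count_eq_one ht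
    have hy := List.count_eq_zero.1 hy
    have hz := List.count_eq_zero.1 hz
    rw [symbols_split (x := x₁) (y := x₂ ++ a :: b :: (y ++ a :: c :: (z ++ b :: c :: t₁)))
      (z := t₂) (by simp) (by simp [*]) (by simp [*])] at hG ⊢
    rw [symbols_split (x := x₁) (y := x₂ ++ b :: a :: (y ++ c :: a :: (z ++ c :: b :: t₁)))
      (z := t₂) (by simp) (by simp [*]) (by simp [*])]
    simpa using seqHomotopic_h3 (ι := some) (a := a) (b := b) (c := c) (x := x₂.map some)
      (y := y.map some) (z := z.map some)
      (t := t₁.map some ++ none :: (x₁.map some ++ t₂.map some)) (by simpa using hG)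
  · obtain ⟨y₁, y₂, rfl, h₁, h₂⟩ := exists_of_count_eq_one hy
    obtain ⟨z₁, z₂, rfl, h₃, h₄⟩ := exists_of_count_eq_one hz
    have hx := List.count_eq_zero.1 hx
    rw [symbols_split (x := x ++ a :: b :: y₁) (y := y₂ ++ a :: c :: z₁) (z := z₂ ++ b :: c :: t)
      (by simp) (by simp [*]) (by simp [*])] at hG ⊢
    rw [symbols_split (x := x ++ b :: a :: y₁) (y := y₂ ++ c :: a :: z₁) (z := z₂ ++ c :: b :: t)
      (by simp) (by simp [*]) (by simp [*])]
    -- The pairs now come in the order second, first, third.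
    simpa using seqHomotopic_h3_third hι (a := a) (b := c) (c := b) (x := y₂.map some)
      (y := z₁.map some ++ none :: x.map some) (z := y₁.map some ++ z₂.map some)
      (t := t.map some) (by simpa using hG)
  · obtain ⟨y₁, y₂, rfl, h₁, h₂⟩ := exists_of_count_eq_one hy
    obtain ⟨t₁, t₂, rfl, h₃, h₄⟩ := exists_of_count_eq_one ht
    have hx := List.count_eq_zero.1 hx
    have hz := List.count_eq_zero.1 hz
    rw [symbols_split (x := x ++ a :: b :: y₁) (y := y₂ ++ a :: c :: (z ++ b :: c :: t₁)) (z := t₂)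
      (by simp) (by simp [*]) (by simp [*])]
    rw [symbols_split (x := x ++ b :: a :: y₁) (y := y₂ ++ c :: a :: (z ++ c :: b :: t₁)) (z := t₂)
      (by simp) (by simp [*]) (by simp [*])] at hG' ⊢
    -- The pairs now come in the order second, third, first.
    simpa using (seqHomotopic_h3_third hι (a := c) (b := a) (c := b) (x := y₂.map some)
      (y := z.map some) (z := t₁.map some ++ none :: x.map some)
      (t := y₁.map some ++ t₂.map some) (by simpa using hG')).symm
  · obtain ⟨z₁, z₂, rfl, h₁, h₂⟩ := exists_of_count_eq_one hz
    obtain ⟨t₁, t₂, rfl, h₃, h₄⟩ := exists_of_count_eq_one ht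
    have hx := List.count_eq_zero.1 hx
    have hy := List.count_eq_zero.1 hy
    rw [symbols_split (x := x ++ a :: b :: (y ++ a :: c :: z₁)) (y := z₂ ++ b :: c :: t₁) (z := t₂)
      (by simp) (by simp [*]) (by simp [*])] at hG ⊢
    rw [symbols_split (x := x ++ b :: a :: (y ++ c :: a :: z₁)) (y := z₂ ++ c :: b :: t₁) (z := t₂)
      (by simp) (by simp [*]) (by simp [*])]
    -- The pairs now come in the order third, first, second.
    simpa using seqHomotopic_h3_second hι (a := b) (b := c) (c := a) (x := z₂.map some)
      (y := t₁.map some ++ none :: x.map some) (z := y.map some)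
      (t := z₁.map some ++ t₂.map some) (by simpa using hG)

/-! ### Invariance of `zo` under open homotopy -/

theorem Zo.add_self (x : Zo) : x + x = 0 := by
  obtain ⟨y, rfl⟩ := QuotientAddGroup.mk'_surjective twoH x
  rw [← map_add, ← AddMonoidHom.mem_ker, QuotientAddGroup.ker_mk']
  exact ⟨y, two_nsmul y⟩

/-- The contribution of the letter `A` to `zo w`, zero if `A` does not appear in `w`. -/
noncomputable def letterTerm (w : GaussWord) (A : ℕ) : Zo :=
  if hA : A ∈ w.1 then
    phi (FreeAbelianGroup.of (mixedClass (phraseAt w A hA))) -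
      phi (FreeAbelianGroup.of (mixedClass (emptyBar w)))
  else 0

theorem letterTerm_of_notMem {w : GaussWord} {A : ℕ} (h : A ∉ w.1) : letterTerm w A = 0 :=
  dif_neg h

theorem zo_eq_sum {w : GaussWord} {T : Finset ℕ} (hT : w.1.toFinset ⊆ T) :
    zo w = ∑ A ∈ T, letterTerm w A := by
  rw [← Finset.sum_subset hT fun A _ hA =>
    letterTerm_of_notMem fun h => hA (List.mem_toFinset.2 h), ← Finset.sum_attach]
  simp only [zo, h, map_sum, map_sub]
  refine Finset.sum_congr rfl fun A _ => ?_
  rw [letterTerm, dif_pos (List.mem_toFinset.1 A.2)]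

theorem letterTerm_congr {u v : GaussWord} {A B : ℕ} (hA : A ∈ u.1) (hB : B ∈ v.1)
    (h : mixedClass (phraseAt u A hA) = mixedClass (phraseAt v B hB))
    (h' : mixedClass (emptyBar u) = mixedClass (emptyBar v)) :
    letterTerm u A = letterTerm v B := by
  rw [letterTerm, letterTerm, dif_pos hA, dif_pos hB, h, h']

theorem mixedClass_emptyBar_eq {u v : GaussWord}
    (h : SeqHomotopic some (none :: u.1.map some) (none :: v.1.map some)) :
    mixedClass (emptyBar u) = mixedClass (emptyBar v) :=
  mixedClass_eq_of_seqHomotopic (by simpa [emptyBar, symbols] using h)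

theorem gaussSeq_none_cons (u : GaussWord) : GaussSeq some (none :: u.1.map some) := by
  have := isGauss_iff_gaussSeq_symbols.1 (emptyBar u).2
  simpa [emptyBar, symbols] using this

theorem zo_eq_of_wordIso {u v : GaussWord} (h : WordIso u.1 v.1) : zo u = zo v := by
  obtain ⟨f, hf, h⟩ := h
  have hbar : mixedClass (emptyBar u) = mixedClass (emptyBar v) :=
    mixedClass_eq_of_map (f := f) (by simpa [emptyBar] using hf.injOn) (by simp [emptyBar, h])
  rw [zo_eq_sum (Finset.Subset.refl u.1.toFinset), zo_eq_sum (Finset.Subset.refl v.1.toFinset)]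
  refine Finset.sum_nbij f (fun A hA => ?_) ?_ ?_ fun A hA => ?_
  · exact List.mem_toFinset.2 (hf.mapsTo (List.mem_toFinset.1 hA))
  · simpa [Set.InjOn] using hf.injOn
  · simpa [Set.SurjOn, Set.subset_def] using hf.surjOn
  · have hA := List.mem_toFinset.1 hA
    refine letterTerm_congr hA (hf.mapsTo hA) ?_ hbar
    obtain ⟨x, y, z, e, hx, hy, hz⟩ := exists_of_count_eq_two (u.2 A hA)
    have hfA : ∀ l : List ℕ, (∀ a ∈ l, a ∈ u.1) → A ∉ l → f A ∉ l.map f := by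
      intro l hl hAl hmem
      obtain ⟨a, ha, ea⟩ := List.mem_map.1 hmem
      exact hAl (hf.injOn (hl a ha) hA ea ▸ ha)
    have e₁ : split u.1 A = (y, x ++ z) := split_append_cons e hx hy
    have e₂ : split v.1 (f A) = (y.map f, (x ++ z).map f) := by
      rw [List.map_append]
      refine split_append_cons (by simp [← h, e])
        (hfA x (fun a ha => ?_) hx) (hfA y (fun a ha => ?_) hy) <;> simp [e, ha]
    refine mixedClass_eq_of_map (f := f) ?_ (by simp only [phraseAt, e₁, e₂])
    refine hf.injOn.mono fun a ha => ?_
    simp only [phraseAt, e₁, Set.mem_ofPred_eq, List.mem_append] at ha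
    simp only [e, Set.mem_ofPred_eq, List.mem_append, List.mem_cons]
    tauto

theorem zo_eq_of_h1 {u v : GaussWord} {a : ℕ} {x y : List ℕ} (hu : u.1 = x ++ a :: a :: y)
    (hv : v.1 = x ++ y) : zo u = zo v := by
  obtain ⟨u, gu⟩ := u
  obtain ⟨v, gv⟩ := v
  subst hu hv
  have ha := gu a (by simp)
  simp only [List.count_append, List.count_cons_self] at ha
  have hax : a ∉ x := List.count_eq_zero.1 (by omega)
  have hay : a ∉ y := List.count_eq_zero.1 (by omega)
  have hbar : mixedClass (emptyBar ⟨_, gu⟩) = mixedClass (emptyBar ⟨_, gv⟩) := by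
    refine mixedClass_emptyBar_eq ?_
    simpa using seqHomotopic_h1 (ι := some) (x := none :: x.map some) (a := a) (y := y.map some)
      (by simpa using gaussSeq_none_cons ⟨_, gu⟩)
  rw [zo_eq_sum (Finset.Subset.refl _), zo_eq_sum (w := ⟨x ++ y, gv⟩)
    (T := (x ++ a :: a :: y).toFinset) (fun b => by simp; tauto)]
  refine Finset.sum_congr rfl fun D hD => ?_
  replace hD := List.mem_toFinset.1 hD
  by_cases hDa : D = a
  · subst hDa
    rw [letterTerm_of_notMem (w := ⟨x ++ y, gv⟩) (by simp [hax, hay]), letterTerm, dif_pos hD, hbar,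
      sub_eq_zero]
    congr 3
    exact Subtype.ext (split_append_cons (x := x) (y := []) (z := y) (by simp) hax (by simp))
  · refine letterTerm_congr hD ?_ (mixedClass_eq_of_seqHomotopic ?_) hbar
    · simpa [hDa] using hD
    · exact seqHomotopic_split_h1 gu hD hDa

theorem zo_eq_of_h2 {u v : GaussWord} {a b : ℕ} {x y z : List ℕ}
    (hu : u.1 = x ++ a :: b :: (y ++ b :: a :: z)) (hv : v.1 = x ++ (y ++ z)) : zo u = zo v := by
  obtain ⟨u, gu⟩ := u
  obtain ⟨v, gv⟩ := v
  subst hu hv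
  have hab : a ≠ b := by
    rintro rfl
    have := gu a (by simp)
    simp only [List.count_append, List.count_cons_self] at this
    omega
  have ha := gu a (by simp)
  have hb := gu b (by simp)
  simp only [List.count_append, List.count_cons_self, List.count_cons_of_ne hab,
    List.count_cons_of_ne hab.symm] at ha hb
  have hax : a ∉ x := List.count_eq_zero.1 (by omega)
  have hay : a ∉ y := List.count_eq_zero.1 (by omega)
  have haz : a ∉ z := List.count_eq_zero.1 (by omega)
  have hbx : b ∉ x := List.count_eq_zero.1 (by omega)
  have hby : b ∉ y := List.count_eq_zero.1 (by omega)
  have hbz : b ∉ z := List.count_eq_zero.1 (by omega)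
  have hbar : mixedClass (emptyBar ⟨_, gu⟩) = mixedClass (emptyBar ⟨_, gv⟩) := by
    refine mixedClass_emptyBar_eq ?_
    simpa using seqHomotopic_h2 (ι := some) (x := none :: x.map some) (a := a) (b := b)
      (y := y.map some) (z := z.map some) (by simpa using gaussSeq_none_cons ⟨_, gu⟩)
  have hT : (x ++ a :: b :: (y ++ b :: a :: z)).toFinset =
      insert a (insert b (x ++ (y ++ z)).toFinset) := by
    ext c
    simp only [List.mem_toFinset, List.mem_append, List.mem_cons, Finset.mem_insert]
    tauto
  rw [zo_eq_sum (w := ⟨_, gu⟩) hT.subset, zo_eq_sum (w := ⟨x ++ (y ++ z), gv⟩)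
    (Finset.Subset.refl _), Finset.sum_insert (by simp [hab, hax, hay, haz]),
    Finset.sum_insert (by simp [hbx, hby, hbz])]
  have hA : a ∈ x ++ a :: b :: (y ++ b :: a :: z) := by simp
  have hB : b ∈ x ++ a :: b :: (y ++ b :: a :: z) := by simp
  have gA := gaussSeq_symbols_split gu hA
  have gB := gaussSeq_symbols_split gu hB
  have sA : split (x ++ a :: b :: (y ++ b :: a :: z)) a = (b :: (y ++ [b]), x ++ z) :=
    split_append_cons (by simp) hax (by simp [hab, hay])
  have sB : split (x ++ a :: b :: (y ++ b :: a :: z)) b = (y, x ++ a :: a :: z) := by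
    rw [split_append_cons (x := x ++ [a]) (y := y) (z := a :: z) (by simp)
      (by simp [hab.symm, hbx]) hby]
    simp
  -- Both `ByB|xz` and `y|xAAz` reduce to `y|xz`, so the two terms cancel modulo two.
  have hterm : letterTerm ⟨_, gu⟩ a = letterTerm ⟨_, gu⟩ b := by
    refine letterTerm_congr hA hB ?_ rfl
    have gS : IsGauss ((y ++ [b] ++ [b]) ++ (x ++ z)) := by
      rw [isGauss_iff_gaussSeq_symbols (p := (y ++ [b] ++ [b], x ++ z))]
      refine gA.perm (List.perm_iff_count.2 fun c => ?_)
      simp only [sA, symbols, List.map_append, List.map_cons, List.map_nil, List.count_append,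
        List.count_cons, List.count_nil]
      ring
    rw [mixedClass_eq_of_shift (q := ⟨(y ++ [b] ++ [b], x ++ z), gS⟩) (by exact sA) rfl]
    refine mixedClass_eq_of_seqHomotopic ?_
    have e₁ := seqHomotopic_h1 (ι := some) (a := b) (x := y.map some)
      (y := none :: (x.map some ++ z.map some))
      (by simpa [symbols] using (isGauss_iff_gaussSeq_symbols
        (p := (y ++ [b] ++ [b], x ++ z))).1 gS)
    have e₂ := seqHomotopic_h1 (ι := some) (a := a) (x := y.map some ++ none :: x.map some)
      (y := z.map some) (by simpa [sB, symbols] using gB)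
    simp only [phraseAt, sB]
    simpa [symbols] using e₁.trans (by simpa using e₂.symm)
  rw [hterm, ← add_assoc, Zo.add_self, zero_add]
  refine Finset.sum_congr rfl fun D hD => ?_
  replace hD := List.mem_toFinset.1 hD
  have hDa : D ≠ a := by rintro rfl; simp_all
  have hDb : D ≠ b := by rintro rfl; simp_all
  have hD' : D ∈ x ++ a :: b :: (y ++ b :: a :: z) := by
    simp only [List.mem_append, List.mem_cons] at hD ⊢
    tauto
  exact letterTerm_congr hD' hD (mixedClass_eq_of_seqHomotopic
    (seqHomotopic_split_h2 gu hD' hDa hDb)) hbar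

theorem mixedClass_eq_of_swap {p q : GaussPhrase} {b c : ℕ}
    (h : q.1 = (p.1.1.map (Equiv.swap b c), p.1.2.map (Equiv.swap b c))) :
    mixedClass p = mixedClass q :=
  mixedClass_eq_of_map (Equiv.injective _).injOn h

theorem map_swap_of_notMem {l : List ℕ} {b c : ℕ} (hb : b ∉ l) (hc : c ∉ l) :
    l.map (Equiv.swap b c) = l := by
  refine (List.map_congr_left fun a ha => ?_).trans (List.map_id l)
  exact Equiv.swap_apply_of_ne_of_ne (by rintro rfl; exact hb ha) (by rintro rfl; exact hc ha)

theorem zo_eq_of_h3 {u v : GaussWord} {a b c : ℕ} {x y z t : List ℕ}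
    (hu : u.1 = x ++ a :: b :: (y ++ a :: c :: (z ++ b :: c :: t)))
    (hv : v.1 = x ++ b :: a :: (y ++ c :: a :: (z ++ c :: b :: t))) : zo u = zo v := by
  obtain ⟨u, gu⟩ := u
  obtain ⟨v, gv⟩ := v
  subst hu hv
  have hι := Option.some_injective ℕ
  have hne : a ≠ b ∧ a ≠ c ∧ b ≠ c := by
    have ha := gu a (by simp)
    have hb := gu b (by simp)
    refine ⟨?_, ?_, ?_⟩ <;> rintro rfl <;>
      simp only [List.count_append, List.count_cons, beq_self_eq_true, if_true] at ha hb <;> omega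
  obtain ⟨hab, hac, hbc⟩ := hne
  have ha := gu a (by simp)
  have hb := gu b (by simp)
  have hc := gu c (by simp)
  simp only [List.count_append, List.count_cons_self, List.count_cons_of_ne hab,
    List.count_cons_of_ne hab.symm, List.count_cons_of_ne hac, List.count_cons_of_ne hac.symm,
    List.count_cons_of_ne hbc, List.count_cons_of_ne hbc.symm] at ha hb hc
  have hax : a ∉ x := List.count_eq_zero.1 (by omega)
  have hay : a ∉ y := List.count_eq_zero.1 (by omega)
  have haz : a ∉ z := List.count_eq_zero.1 (by omega)
  have hat : a ∉ t := List.count_eq_zero.1 (by omega)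
  have hbx : b ∉ x := List.count_eq_zero.1 (by omega)
  have hby : b ∉ y := List.count_eq_zero.1 (by omega)
  have hbz : b ∉ z := List.count_eq_zero.1 (by omega)
  have hbt : b ∉ t := List.count_eq_zero.1 (by omega)
  have hcx : c ∉ x := List.count_eq_zero.1 (by omega)
  have hcy : c ∉ y := List.count_eq_zero.1 (by omega)
  have hcz : c ∉ z := List.count_eq_zero.1 (by omega)
  have hct : c ∉ t := List.count_eq_zero.1 (by omega)
  have hbar : mixedClass (emptyBar ⟨_, gu⟩) = mixedClass (emptyBar ⟨_, gv⟩) := by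
    refine mixedClass_emptyBar_eq ?_
    simpa using seqHomotopic_h3 (ι := some) (x := none :: x.map some) (a := a) (b := b) (c := c)
      (y := y.map some) (z := z.map some) (t := t.map some)
      (by simpa using gaussSeq_none_cons ⟨_, gu⟩)
  rw [zo_eq_sum (Finset.Subset.refl _), zo_eq_sum
    (w := ⟨x ++ b :: a :: (y ++ c :: a :: (z ++ c :: b :: t)), gv⟩)
    (T := (x ++ a :: b :: (y ++ a :: c :: (z ++ b :: c :: t))).toFinset) (fun d => by simp; tauto)]
  refine Finset.sum_congr rfl fun D hD => ?_
  replace hD := List.mem_toFinset.1 hD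
  have hD' : D ∈ x ++ b :: a :: (y ++ c :: a :: (z ++ c :: b :: t)) := by
    simp only [List.mem_append, List.mem_cons] at hD ⊢
    tauto
  refine letterTerm_congr hD hD' ?_ hbar
  have gD' := split_isGauss ⟨_, gv⟩ D hD'
  have gD := split_isGauss ⟨_, gu⟩ D hD
  by_cases hDa : D = a
  · subst hDa
    -- `By|xCzBCt` is shifted to `yB|xCzBCt`, which is isomorphic to `yC|xBzCBt`.
    have s₁ : split (x ++ D :: b :: (y ++ D :: c :: (z ++ b :: c :: t))) D =
        (b :: y, x ++ c :: (z ++ b :: c :: t)) :=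
      split_append_cons (by simp) hax (by simp [hab, hay])
    have s₂ : split (x ++ b :: D :: (y ++ c :: D :: (z ++ c :: b :: t))) D =
        (y ++ [c], x ++ b :: (z ++ c :: b :: t)) := by
      rw [split_append_cons (x := x ++ [b]) (y := y ++ [c]) (z := z ++ c :: b :: t) (by simp)
        (by simp [hab, hax]) (by simp [hac, hay])]
      simp
    have gS : IsGauss ((y ++ [b]) ++ (x ++ c :: (z ++ b :: c :: t))) := by
      simp only [s₁] at gD
      rw [isGauss_iff_gaussSeq] at gD ⊢
      refine gD.perm (List.perm_iff_count.2 fun c => ?_)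
      simp only [List.count_append, List.count_cons, List.count_nil]
      ring
    rw [mixedClass_eq_of_shift (q := ⟨(y ++ [b], x ++ c :: (z ++ b :: c :: t)), gS⟩)
      (by exact s₁) rfl]
    refine mixedClass_eq_of_swap (b := b) (c := c) ?_
    simp only [phraseAt, s₂]
    simp [map_swap_of_notMem, *]
  by_cases hDb : D = b
  · subst hDb
    -- `yACz|xACt` and the shift `yCAzCA|xt` of `AyCAzC|xt` both reduce to `yz|xt`.
    have s₁ : split (x ++ a :: D :: (y ++ a :: c :: (z ++ D :: c :: t))) D =
        (y ++ a :: c :: z, x ++ a :: c :: t) := by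
      rw [split_append_cons (x := x ++ [a]) (y := y ++ a :: c :: z) (z := c :: t) (by simp)
        (by simp [hab.symm, hbx]) (by simp [hab.symm, hbc, hby, hbz])]
      simp
    have s₂ : split (x ++ D :: a :: (y ++ c :: a :: (z ++ c :: D :: t))) D =
        (a :: (y ++ c :: a :: (z ++ [c])), x ++ t) :=
      split_append_cons (by simp) hbx (by simp [hab.symm, hbc, hby, hbz])
    have gS : IsGauss ((y ++ c :: a :: (z ++ [c]) ++ [a]) ++ (x ++ t)) := by
      simp only [s₂] at gD'
      rw [isGauss_iff_gaussSeq] at gD' ⊢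
      refine gD'.perm (List.perm_iff_count.2 fun c => ?_)
      simp only [List.count_append, List.count_cons, List.count_nil]
      ring
    rw [mixedClass_eq_of_shift (p := phraseAt ⟨_, gv⟩ _ hD')
      (q := ⟨(y ++ c :: a :: (z ++ [c]) ++ [a], x ++ t), gS⟩) (by exact s₂) rfl]
    refine mixedClass_eq_of_seqHomotopic ?_
    simp only [s₁] at gD
    have e₁ := seqHomotopic_h2_parallel hι (a := a) (b := c) (x := y.map some)
      (y := z.map some ++ none :: x.map some) (z := t.map some)
      (by simpa [symbols] using (isGauss_iff_gaussSeq_symbols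
        (p := (y ++ a :: c :: z, x ++ a :: c :: t))).1 gD)
    have e₂ := seqHomotopic_h2_parallel hι (a := c) (b := a) (x := y.map some)
      (y := z.map some) (z := none :: (x.map some ++ t.map some))
      (by simpa [symbols] using (isGauss_iff_gaussSeq_symbols
        (p := (y ++ c :: a :: (z ++ [c]) ++ [a], x ++ t))).1 gS)
    simp only [phraseAt, s₁]
    simpa [symbols] using e₁.trans (by simpa using e₂.symm)
  by_cases hDc : D = c
  · subst hDc
    -- `Az|xBAyBt` is shifted to `zA|xBAyBt`, which is isomorphic to `zB|xAByAt`.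
    have s₁ : split (x ++ a :: b :: (y ++ a :: D :: (z ++ b :: D :: t))) D =
        (z ++ [b], x ++ a :: b :: (y ++ a :: t)) := by
      rw [split_append_cons (x := x ++ a :: b :: (y ++ [a])) (y := z ++ [b]) (z := t) (by simp)
        (by simp [*]) (by simp [*])]
      simp
    have s₂ : split (x ++ b :: a :: (y ++ D :: a :: (z ++ D :: b :: t))) D =
        (a :: z, x ++ b :: a :: (y ++ b :: t)) := by
      rw [split_append_cons (x := x ++ b :: a :: y) (y := a :: z) (z := b :: t) (by simp)
        (by simp [*]) (by simp [*])]
      simp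
    have gS : IsGauss ((z ++ [a]) ++ (x ++ b :: a :: (y ++ b :: t))) := by
      simp only [s₂] at gD'
      rw [isGauss_iff_gaussSeq] at gD' ⊢
      refine gD'.perm (List.perm_iff_count.2 fun c => ?_)
      simp only [List.count_append, List.count_cons, List.count_nil]
      ring
    rw [mixedClass_eq_of_shift (p := phraseAt ⟨_, gv⟩ _ hD')
      (q := ⟨(z ++ [a], x ++ b :: a :: (y ++ b :: t)), gS⟩) (by exact s₂) rfl]
    refine mixedClass_eq_of_swap (b := a) (c := b) ?_
    simp only [phraseAt, s₁]
    simp [map_swap_of_notMem, *]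
  · exact mixedClass_eq_of_seqHomotopic (seqHomotopic_split_h3 gu hD hDa hDb hDc)

theorem zo_eq_of_hMove {u v : GaussWord} (h : HMove id u.1 v.1) : zo u = zo v := by
  generalize hs : u.1 = s at h
  generalize ht : v.1 = t at h
  cases h with
  | h1 A x y => exact zo_eq_of_h1 (a := A) (x := x) (y := y) (by simp [hs]) ht
  | h2 A B x y z =>
    exact zo_eq_of_h2 (a := A) (b := B) (x := x) (y := y) (z := z) (by simp [hs]) (by simp [ht])
  | h3 A B C x y z t =>
    exact zo_eq_of_h3 (a := A) (b := B) (c := C) (x := x) (y := y) (z := z) (t := t)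
      (by simp [hs]) (by simp [ht])

theorem zo_eq_of_openHomotopic {u v : GaussWord} (h : OpenHomotopic u v) : zo u = zo v := by
  induction h with
  | rel _ _ h => exact h.elim zo_eq_of_wordIso zo_eq_of_hMove
  | refl _ => rfl
  | symm _ _ _ ih => exact ih.symm
  | trans _ _ _ _ _ ih₁ ih₂ => exact ih₁.trans ih₂

/-! ### The word `ABACDCBD` -/

theorem OpenHomotopic.homotopic {u v : GaussWord} (h : OpenHomotopic u v) : Homotopic u v :=
  have hle : OpenStep ≤ HomotopyStep := fun _ _ h => h.imp id Or.inl
  Relation.EqvGen.mono hle _ _ h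

theorem openHomotopic_of_seqHomotopic {u v : GaussWord} (h : SeqHomotopic id u.1 v.1) :
    OpenHomotopic u v := by
  refine SeqHomotopic.of_spelling (F := Subtype.val) (R := OpenHomotopic) Subtype.val_injective
    (Relation.EqvGen.is_equivalence _) (fun p q hm => Relation.EqvGen.rel _ _ (Or.inr hm))
    (fun s t hs ht _ => ?_) h
  exact iff_of_true ⟨⟨s, isGauss_iff_gaussSeq.2 hs⟩, rfl⟩ ⟨⟨t, isGauss_iff_gaussSeq.2 ht⟩, rfl⟩

theorem homotopic_of_shiftMove {u v : GaussWord} (h : ShiftMove u.1 v.1) : Homotopic u v :=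
  Relation.EqvGen.rel _ _ (Or.inr (Or.inr h))

/-- The word is trivial up to shifts: `ABACDCBD` is shifted to `BACDCBDA`, taken by H3 to
`BCACDBAD`, shifted back to `DBCACDBA`, and the pairs `DB` and `CA` are removed in turn by the
parallel form of H2. -/
theorem homotopic_wordABACDCBD : Homotopic wordABACDCBD emptyWord := by
  have hι : Function.Injective (id : ℕ → ℕ) := Function.injective_id
  let w₁ : GaussWord := ⟨[1, 0, 2, 3, 2, 1, 3, 0], by decide⟩
  let w₂ : GaussWord := ⟨[1, 2, 0, 2, 3, 1, 0, 3], by decide⟩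
  let w₃ : GaussWord := ⟨[3, 1, 2, 0, 2, 3, 1, 0], by decide⟩
  let w₄ : GaussWord := ⟨[2, 0, 2, 0], by decide⟩
  have e₁ : Homotopic wordABACDCBD w₁ :=
    homotopic_of_shiftMove (ShiftMove.shift 0 [1] [2, 3, 2, 1, 3])
  have e₂ : OpenHomotopic w₁ w₂ := openHomotopic_of_seqHomotopic
    (seqHomotopic_h3_symm (ι := id) (a := 2) (b := 0) (c := 3) (x := [1]) (y := []) (z := [1])
      (t := []) (isGauss_iff_gaussSeq.1 w₁.2))
  have e₃ : Homotopic w₃ w₂ :=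
    homotopic_of_shiftMove (ShiftMove.shift 3 [1, 2, 0, 2] [1, 0])
  have e₄ : OpenHomotopic w₃ w₄ := openHomotopic_of_seqHomotopic
    (seqHomotopic_h2_parallel hι (a := 3) (b := 1) (x := []) (y := [2, 0, 2]) (z := [0])
      (isGauss_iff_gaussSeq.1 w₃.2))
  have e₅ : OpenHomotopic w₄ emptyWord := openHomotopic_of_seqHomotopic
    (seqHomotopic_h2_parallel hι (a := 2) (b := 0) (x := []) (y := []) (z := [])
      (isGauss_iff_gaussSeq.1 w₄.2))
  have trans {u v w : GaussWord} (h : Homotopic u v) (h' : Homotopic v w) : Homotopic u w :=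
    Relation.EqvGen.trans _ _ _ h h'
  exact trans e₁ (trans e₂.homotopic (trans (Relation.EqvGen.symm _ _ e₃)
    (trans e₄.homotopic e₅.homotopic)))

theorem zo_wordABACDCBD :
    zo wordABACDCBD =
      phi (FreeAbelianGroup.of (mixedClass phraseA)) +
      phi (FreeAbelianGroup.of (mixedClass phraseB)) +
      phi (FreeAbelianGroup.of (mixedClass phraseC)) +
      phi (FreeAbelianGroup.of (mixedClass phraseD)) := by
  have hT : wordABACDCBD.1.toFinset = {0, 1, 2, 3} := by decide
  have h₀ : (0 : ℕ) ∈ wordABACDCBD.1 := by decide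
  have h₁ : (1 : ℕ) ∈ wordABACDCBD.1 := by decide
  have h₂ : (2 : ℕ) ∈ wordABACDCBD.1 := by decide
  have h₃ : (3 : ℕ) ∈ wordABACDCBD.1 := by decide
  have e₀ : phraseAt wordABACDCBD 0 h₀ = phraseA :=
    Subtype.ext (by decide : split wordABACDCBD.1 0 = phraseA.1)
  have e₁ : phraseAt wordABACDCBD 1 h₁ = phraseB :=
    Subtype.ext (by decide : split wordABACDCBD.1 1 = phraseB.1)
  have e₃ : phraseAt wordABACDCBD 3 h₃ = phraseD :=
    Subtype.ext (by decide : split wordABACDCBD.1 3 = phraseD.1)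
  -- Splitting at `C` gives `D|ABABD`, where the parallel form of H2 removes `A` and `B`.
  have e₂ : mixedClass (phraseAt wordABACDCBD 2 h₂) = mixedClass phraseC := by
    refine mixedClass_eq_of_seqHomotopic ?_
    have hs : symbols (phraseAt wordABACDCBD 2 h₂).1 =
        [some 3, none] ++ some 0 :: some 1 :: ([] ++ some 0 :: some 1 :: [some 3]) := by
      change symbols (split wordABACDCBD.1 2) = _
      decide
    have hG := isGauss_iff_gaussSeq_symbols.1 (phraseAt wordABACDCBD 2 h₂).2
    rw [hs] at hG ⊢
    exact seqHomotopic_h2_parallel (Option.some_injective ℕ) hG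
  rw [zo_eq_sum hT.subset, Finset.sum_insert (by decide), Finset.sum_insert (by decide),
    Finset.sum_insert (by decide), Finset.sum_singleton, letterTerm, letterTerm, letterTerm,
    letterTerm, dif_pos h₀, dif_pos h₁, dif_pos h₂, dif_pos h₃, e₀, e₁, e₂, e₃]
  set e := phi (FreeAbelianGroup.of (mixedClass (emptyBar wordABACDCBD)))
  have he : -e = e := neg_eq_of_add_eq_zero_left (Zo.add_self e)
  simp only [sub_eq_add_neg, he]
  have h4 : e + e + (e + e) = 0 := Zo.add_self (e + e)
  rw [← add_zero (_ + _ + _ + phi _), ← h4]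
  abel

/-- The sum is detected by counting the class of `phraseA` modulo two. -/
theorem zo_wordABACDCBD_ne_zero : zo wordABACDCBD ≠ 0 := by
  classical
  intro h0
  have hnd := mixedClass_nodup
  simp only [List.nodup_cons, List.mem_cons, List.not_mem_nil, or_false, not_or] at hnd
  obtain ⟨⟨hAB, hAC, hAD⟩, -⟩ := hnd
  rw [zo_wordABACDCBD, ← map_add, ← map_add, ← map_add, ← AddMonoidHom.mem_ker, phi,
    QuotientAddGroup.ker_mk'] at h0
  obtain ⟨y, hy⟩ := h0
  have key := congrArg (FreeAbelianGroup.lift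
    fun c : MixedClass => if c = mixedClass phraseA then (1 : ZMod 2) else 0) hy
  simp only [nsmulAddMonoidHom_apply, map_add, FreeAbelianGroup.lift_apply_of, if_true,
    if_neg (Ne.symm hAB), if_neg (Ne.symm hAC), if_neg (Ne.symm hAD), add_zero, two_nsmul,
    CharTwo.add_self_eq_zero] at key
  exact zero_ne_one key

theorem zo_emptyWord : zo emptyWord = 0 :=
  zo_eq_sum (w := emptyWord) (T := ∅) (by decide)

theorem not_openHomotopic_wordABACDCBD : ¬ OpenHomotopic wordABACDCBD emptyWord := fun h =>
  zo_wordABACDCBD_ne_zero ((zo_eq_of_openHomotopic h).trans zo_emptyWord)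

end GaussHomotopy

open GaussHomotopy in
theorem mainTheorem5 :
    Homotopic wordABACDCBD emptyWord ∧
    [mixedClass phraseA, mixedClass phraseB, mixedClass phraseC, mixedClass phraseD].Nodup ∧
    zo wordABACDCBD =
      phi (FreeAbelianGroup.of (mixedClass phraseA)) +
      phi (FreeAbelianGroup.of (mixedClass phraseB)) +
      phi (FreeAbelianGroup.of (mixedClass phraseC)) +
      phi (FreeAbelianGroup.of (mixedClass phraseD)) ∧
    zo wordABACDCBD ≠ 0 ∧
    ¬ OpenHomotopic wordABACDCBD emptyWord ∧
    (∀ u v : GaussWord, OpenHomotopic u v → Homotopic u v) ∧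
    (∃ u v : GaussWord, Homotopic u v ∧ ¬ OpenHomotopic u v) :=
  ⟨homotopic_wordABACDCBD, mixedClass_nodup, zo_wordABACDCBD, zo_wordABACDCBD_ne_zero,
    not_openHomotopic_wordABACDCBD, fun _ _ h => h.homotopic,
    wordABACDCBD, emptyWord, homotopic_wordABACDCBD, not_openHomotopic_wordABACDCBD⟩
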